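/- **Setting.** There are $K\ge 2$ arms, partitioned into known non-empty sets $\mathcal A_1,\dots,\mathcal A_M$, one for each of $M$ boxes. Selecting box $m$ pulls arm $k\in\mathcal A_m$ with unknown probability $q_{m,k}>0$, where $\sum_{k\in\mathcal A_m}q_{m,k}=1$; the learner sees which arm was pulled and a reward drawn from the unknown law of that arm, which is $1$-sub-Gaussian with mean $\mu_{m,k}$. These data form an instance. Assume that the best arm (the one of largest mean $\mu^*$) is unique; let $\Delta_{m,k}=\mu^*-\mu_{m,k}$ for every other arm, and let the gap $\Delta_{m,k}$ of the best arm be the smallest of these numbers. A policy maps each history (boxes, arms, rewards) to a possibly randomised action: select a box, or stop and declare an arm; its stopping time $\tau$ is the number of box selections made before it stops. For $\delta\in(0,1)$, a policy is $\delta$-PC if, on every instance with the given arm sets and a unique best arm, the probability of stopping and declaring an arm other than the best one is at most $\delta$. **Algorithm (BBSEA).** All arms are active at first. In round $n=1,2,\dots$, as long as more than one arm is active, each box containing an active arm is selected until each of its active arms has been pulled at least $n$ times in total. Then every active arm whose upper confidence bound is smaller than the lower confidence bound of some active arm is eliminated; the bounds of an arm pulled $x$ times are its empirical mean $\pm\sqrt{2\log(8Kx^2/\delta)/x}$.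 When a single arm is active, the algorithm stops and declares it. **Theorem.** Let $$\alpha_{m,k}=1+\frac{102}{\Delta_{m,k}^2}\log\frac{64\sqrt{8K/\delta}}{\Delta_{m,k}^2},\qquad \beta_{m,k}=\frac1{q_{m,k}}\Big[\alpha_{m,k}+2\log\tfrac{2K}\delta+2\sqrt{\log\tfrac{2K}\delta\big(\log\tfrac{2K}\delta+\alpha_{m,k}\big)}\Big],\qquad \beta_m=\max_{k\in\mathcal A_m}\beta_{m,k}.$$ 1. For every $\delta\in(0,1)$ and every instance with a unique best arm, with probability greater than $1-\delta$ BBSEA declares the best arm and its stopping time is at most $\sum_{m=1}^M\beta_m$. 2. $\beta_m=O\Big(\max_{k\in\mathcal A_m}\frac{\log(K/(\delta\Delta_{m,k}))}{q_{m,k}\Delta_{m,k}^2}\Big)$, as long as gaps are bounded and $K/(\delta\Delta_{m,k})$ stays away from $1$: for all $D$ and $r>1$ there is a constant $c$, depending only on $D$ and $r$, such that $\beta_m\le c\max_{k\in\mathcal A_m}\frac{\log(K/(\delta\Delta_{m,k}))}{q_{m,k}\Delta_{m,k}^2}$ for every instance, every $\delta\in(0,1)$ and every box $m$ with $\Delta_{m,k}\le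 D$ and $K/(\delta\Delta_{m,k})\ge r$ for all $k\in\mathcal A_m$. 3. Conversely, for every $\delta\in(0,1)$, every $\delta$-PC policy and every instance $(\boldsymbol q,\boldsymbol\mu)$ with a unique best arm, in which arm $k$ of box $m$ has reward law $\mathcal N(\mu_{m,k},1)$, $$\mathbb E[\tau]\ \ge\ \log\Big(\frac1{2.4\,\delta}\Big)\sum_{m=1}^M\max_{k\in\mathcal A_m}\frac1{q_{m,k}\Delta_{m,k}^2}.$$ -/

import Mathlib

open MeasureTheory ProbabilityTheory Finset
open scoped ENNReal

noncomputable section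

namespace BoxedBandit

/-! ### Instances

There are `K` arms and `M` boxes.  The map `box : Fin K → Fin M` sends an arm to the unique box that
gives access to it, so the arm sets `{k | box k = m}` of the boxes form a partition of the arms. -/

/-- A problem instance: when box `m` is selected, arm `k` of that box is pulled with probability
`q k > 0`, and a pull of arm `k` yields a reward with the `1`-sub-Gaussian law `ν k`. -/
structure Problem {M K : ℕ} (box : Fin K → Fin M) where
  q : Fin K → ℝ
  ν : Fin K → Measure ℝ
  q_pos : ∀ k, 0 < q k
  q_sum : ∀ m, ∑ k with box k = m, q k = 1
  prob : ∀ k, IsProbabilityMeasure (ν k)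
  subGaussian : ∀ k, HasSubgaussianMGF (fun x => x - ∫ y, y ∂(ν k)) 1 (ν k)

variable {M K : ℕ} {box : Fin K → Fin M}

/-- The mean reward of an arm. -/
def Problem.mean (C : Problem box) (k : Fin K) : ℝ := ∫ x, x ∂(C.ν k)

/-- `b` is the unique best arm of the instance. -/
def Problem.IsBest (C : Problem box) (b : Fin K) : Prop := ∀ k, k ≠ b → C.mean k < C.mean b

/-- The instance has Gaussian rewards of variance `1`. -/
def Problem.IsUnitGaussian (C : Problem box) : Prop :=
  ∀ k, C.ν k = gaussianReal (C.mean k) 1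

/-- The gaps when `b` is the best arm: `μ_b - μ_k` for `k ≠ b`, and the smallest of these numbers
for `b` itself. -/
def Problem.gap (C : Problem box) (b k : Fin K) : ℝ :=
  if k = b then ⨅ j : {j : Fin K // j ≠ b}, (C.mean b - C.mean j) else C.mean b - C.mean k

/-- The law of the pair (arm, reward) that results from a selection of box `m`. -/
def Problem.boxLaw (C : Problem box) (m : Fin M) : Measure (Fin K × ℝ) :=
  ∑ k with box k = m, ENNReal.ofReal (C.q k) • (Measure.dirac k).prod (C.ν k)

instance Problem.isProbabilityMeasure_boxLaw (C : Problem box) (m : Fin M) :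
    IsProbabilityMeasure (C.boxLaw m) := by
  constructor
  have h : ∀ k, (Measure.dirac k).prod (C.ν k) Set.univ = 1 := fun k => by
    have := C.prob k
    exact measure_univ
  simp only [Problem.boxLaw, Measure.coe_finsetSum, Finset.sum_apply, Measure.smul_apply, h,
    smul_eq_mul, mul_one]
  rw [← ENNReal.ofReal_sum_of_nonneg (fun k _ => (C.q_pos k).le), C.q_sum, ENNReal.ofReal_one]

/-! ### Policies and the process they generate -/

/-- What is observed at one time step: selected box, pulled arm, reward. -/
abbrev Obs (M K : ℕ) : Type := Fin M × Fin K × ℝ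

/-- The history after `t` box selections. -/
abbrev History (M K t : ℕ) : Type := Fin t → Obs M K

/-- An action: select a box, or stop and declare an arm. -/
abbrev Act (M K : ℕ) : Type := Fin M ⊕ Fin K

/-- A (possibly randomised) policy maps each history to a probability law on actions. -/
structure Policy (M K : ℕ) where
  act : ∀ t, Kernel (History M K t) (Act M K)
  markov : ∀ t, IsMarkovKernel (act t)

instance : MeasurableSingletonClass (Act M K) where
  measurableSet_singleton x := by
    cases x with
    | inl m => simpa using (MeasurableSet.singleton m).inl_image (β := Fin K)
    | inr a => simpa using (MeasurableSet.singleton a).inr_image (α := Fin M)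

/-- The state at time `t`: the history of `t` box selections if the policy has not stopped yet, and
otherwise the arm that was declared at stoppage. -/
abbrev State (M K t : ℕ) : Type := History M K t ⊕ Fin K

/-- The law of the next state, given the present history and the chosen action. -/
def Problem.next (C : Problem box) (t : ℕ) (p : History M K t × Act M K) :
    Measure (State M K (t + 1)) :=
  match p.2 with
  | .inl m => (C.boxLaw m).map fun y => Sum.inl (Fin.snoc (α := fun _ => Obs M K) p.1 (m, y))
  | .inr a => Measure.dirac (Sum.inr a)

lemma measurable_snoc (t : ℕ) (m : Fin M) :
    Measurable fun p : History M K t × (Fin K × ℝ) =>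
      (Fin.snoc (α := fun _ => Obs M K) p.1 (m, p.2) : History M K (t + 1)) := by
  refine measurable_pi_iff.2 fun i => ?_
  induction i using Fin.lastCases with
  | last => simp only [Fin.snoc_last]; fun_prop
  | cast i => simp only [Fin.snoc_castSucc]; fun_prop

lemma Problem.measurable_next (C : Problem box) (t : ℕ) : Measurable (C.next t) := by
  refine measurable_from_prod_countable_left fun x => ?_
  cases x with
  | inr a => exact measurable_const
  | inl m =>
    have h : (fun h : History M K t => C.next t (h, Sum.inl m)) =
        fun h => ((Kernel.id ×ₖ Kernel.const (History M K t) (C.boxLaw m)).map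
          (fun p : History M K t × (Fin K × ℝ) =>
            (Sum.inl (Fin.snoc (α := fun _ => Obs M K) p.1 (m, p.2)) :
              State M K (t + 1)))) h := by
      funext h
      have hm : Measurable fun p : History M K t × (Fin K × ℝ) =>
          (Sum.inl (Fin.snoc (α := fun _ => Obs M K) p.1 (m, p.2)) : State M K (t + 1)) :=
        measurable_inl.comp (measurable_snoc t m)
      rw [Kernel.map_apply _ hm, Kernel.prod_apply, Kernel.id_apply, Kernel.const_apply,
        Measure.dirac_prod, Measure.map_map hm (by fun_prop)]
      rfl
    rw [h]
    exact Kernel.measurable _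

/-- `next` as a kernel. -/
def Problem.nextKernel (C : Problem box) (t : ℕ) :
    Kernel (History M K t × Act M K) (State M K (t + 1)) := ⟨C.next t, C.measurable_next t⟩

instance (C : Problem box) (t : ℕ) : IsMarkovKernel (C.nextKernel t) := by
  constructor
  rintro ⟨h, m | a⟩
  · exact Measure.isProbabilityMeasure_map
      ((measurable_inl.comp ((measurable_snoc t m).comp measurable_prodMk_left)).aemeasurable)
  · exact Measure.dirac.isProbabilityMeasure

/-- One step of the process: a running policy draws an action from its law given the history, and
the box responds; a policy that has stopped stays stopped with the same declared arm. -/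
def Policy.step (π : Policy M K) (C : Problem box) (t : ℕ) :
    Kernel (State M K t) (State M K (t + 1)) where
  toFun := Sum.elim
    (fun h => (C.nextKernel t ∘ₖ (Kernel.id ×ₖ π.act t)) h)
    (fun a => Measure.dirac (Sum.inr a))
  measurable' := (Kernel.measurable _).sumElim (Measure.measurable_dirac.comp measurable_inr)

instance (π : Policy M K) (C : Problem box) (t : ℕ) : IsMarkovKernel (π.step C t) := by
  have := π.markov t
  constructor
  rintro (h | a)
  · exact inferInstanceAs (IsProbabilityMeasure ((C.nextKernel t ∘ₖ (Kernel.id ×ₖ π.act t)) h))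
  · exact Measure.dirac.isProbabilityMeasure

/-- Trajectories of states. -/
abbrev Traj (M K : ℕ) : Type := ∀ t, State M K t

/-- The law of the trajectory when policy `π` runs on instance `C`, starting from the empty
history. -/
def Policy.law (π : Policy M K) (C : Problem box) : Measure (Traj M K) :=
  Kernel.trajMeasure (X := State M K) (Measure.dirac (Sum.inl fun i : Fin 0 => i.elim0))
    fun t => (π.step C t).comap (fun x => x ⟨t, Finset.mem_Iic.2 le_rfl⟩) (measurable_pi_apply _)

/-- The stopping time: the number of box selections made before the policy stops, `∞` if it never
stops. -/
def stopTime (ω : Traj M K) : ℝ≥0∞ := ⨅ (t : ℕ) (_ : (ω (t + 1)).isRight), (t : ℝ≥0∞)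

/-- The policy stops and declares arm `a`. -/
def Declares (ω : Traj M K) (a : Fin K) : Prop := ∃ t, ω t = Sum.inr a

/-- `π` is `δ`-probably correct for the known arm sets given by `box`: on every instance, the
probability of stopping and declaring an arm that is not the best one is at most `δ`. -/
def Policy.IsPC (π : Policy M K) (box : Fin K → Fin M) (δ : ℝ) : Prop :=
  ∀ (C : Problem box) (b : Fin K), C.IsBest b →
    π.law C {ω | ∃ a, a ≠ b ∧ Declares ω a} ≤ ENNReal.ofReal δ

/-! ### The Boxed-Bandit Successive Elimination Algorithm -/

/-- The confidence radius `α_δ(x)`. -/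
def radius (K : ℕ) (δ : ℝ) (x : ℕ) : ℝ := √(2 * Real.log (8 * K * (x : ℝ) ^ 2 / δ) / x)

/-- The variables of the algorithm: round number, active arms, and for each arm the number of pulls
and the sum of the rewards so far. -/
@[ext] structure Memory (K : ℕ) where
  round : ℕ
  active : Finset (Fin K)
  pulls : Fin K → ℕ
  total : Fin K → ℝ

namespace Memory

/-- The variables at the beginning of the first round. -/
def init (K : ℕ) : Memory K where
  round := 1
  active := Finset.univ
  pulls _ := 0
  total _ := 0

def ucb (δ : ℝ) (s : Memory K) (k : Fin K) : ℝ := s.total k / s.pulls k + radius K δ (s.pulls k)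

def lcb (δ : ℝ) (s : Memory K) (k : Fin K) : ℝ := s.total k / s.pulls k - radius K δ (s.pulls k)

/-- Record a pull of arm `k` with reward `x`. -/
def record (s : Memory K) (k : Fin K) (x : ℝ) : Memory K where
  round := s.round
  active := s.active
  pulls := Function.update s.pulls k (s.pulls k + 1)
  total := Function.update s.total k (s.total k + x)

open Classical in
/-- The active arms that survive the elimination at the end of a round. -/
def survivors (δ : ℝ) (s : Memory K) : Finset (Fin K) :=
  s.active.filter fun k => ¬ ∃ j ∈ s.active, ucb δ s k < lcb δ s j

/-- The boxes with an active arm that the current round still has to pull. -/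
def pending (box : Fin K → Fin M) (s : Memory K) : Finset (Fin M) :=
  (s.active.filter fun k => s.pulls k < s.round).image box

/-- If more than one arm is active and no box has to be selected any more in the current round, end
the round with the elimination and begin the next one; otherwise do nothing. -/
def endRound (δ : ℝ) (s : Memory K) : Memory K :=
  if 1 < #s.active ∧ ∀ k ∈ s.active, s.round ≤ s.pulls k then
    { s with round := s.round + 1, active := survivors δ s }
  else s

/-- End rounds until a box has to be selected or a single arm is left.  A round can only end if some
arm has been pulled at least as often as the round number says, so the total number of pulls bounds
the number of rounds that can end. -/
def settle (δ : ℝ) (s : Memory K) : Memory K := (endRound δ)^[∑ k, s.pulls k] s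

/-- The variables of the algorithm after a history of `t` box selections. -/
def after (δ : ℝ) : ∀ t, History M K t → Memory K
  | 0, _ => init K
  | t + 1, h =>
    settle δ ((after δ t (Fin.init h)).record (h (Fin.last t)).2.1 (h (Fin.last t)).2.2)

/-- While more than one arm is active, select a box that the current round still has to serve (the
boxes are served in their order); otherwise stop and declare the active arm. -/
def decide (box : Fin K → Fin M) [NeZero K] (s : Memory K) : Act M K :=
  if h : 1 < #s.active ∧ (pending box s).Nonempty then Sum.inl ((pending box s).min' h.2)
  else if h : s.active.Nonempty then Sum.inr (s.active.min' h) else Sum.inr 0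

/-! Measurability in the history. -/

variable {α : Type*} [MeasurableSpace α]

/-- All variables depend measurably on a parameter. -/
structure IsMeas (f : α → Memory K) : Prop where
  round : Measurable fun a => (f a).round
  active : Measurable fun a => (f a).active
  pulls : ∀ k, Measurable fun a => (f a).pulls k
  total : ∀ k, Measurable fun a => (f a).total k

lemma measurable_radius (δ : ℝ) : Measurable (radius K δ) := Measurable.of_discrete

lemma IsMeas.ucb {f : α → Memory K} (hf : IsMeas f) (δ : ℝ) (k : Fin K) :
    Measurable fun a => Memory.ucb δ (f a) k := by
  have h1 := hf.pulls k
  have h2 := hf.total k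
  have h3 := (measurable_radius (K := K) δ).comp h1
  have h4 : Measurable fun a => (((f a).pulls k : ℕ) : ℝ) := measurable_from_top.comp h1
  exact (h2.div h4).add h3

lemma IsMeas.lcb {f : α → Memory K} (hf : IsMeas f) (δ : ℝ) (k : Fin K) :
    Measurable fun a => Memory.lcb δ (f a) k := by
  have h1 := hf.pulls k
  have h2 := hf.total k
  have h3 := (measurable_radius (K := K) δ).comp h1
  have h4 : Measurable fun a => (((f a).pulls k : ℕ) : ℝ) := measurable_from_top.comp h1
  exact (h2.div h4).sub h3

lemma IsMeas.survivors {f : α → Memory K} (hf : IsMeas f) (δ : ℝ) :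
    Measurable fun a => Memory.survivors δ (f a) := by
  refine measurable_finset_iff.2 fun k => ?_
  have h : ∀ j, Measurable fun a => j ∈ (f a).active := measurable_finset_iff.1 hf.active
  simp only [Memory.survivors, Finset.mem_filter]
  refine (h k).and (Measurable.not (Measurable.exists fun j => (h j).and ?_))
  exact measurableSet_setOfPred.1 (measurableSet_lt (hf.ucb δ k) (hf.lcb δ j))

lemma IsMeas.endRound {f : α → Memory K} (hf : IsMeas f) (δ : ℝ) :
    IsMeas fun a => Memory.endRound δ (f a) := by
  have h : ∀ j, Measurable fun a => j ∈ (f a).active := measurable_finset_iff.1 hf.active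
  have hs : MeasurableSet {a | 1 < #(f a).active ∧
      ∀ k ∈ (f a).active, (f a).round ≤ (f a).pulls k} := by
    refine MeasurableSet.inter ?_ ?_
    · exact hf.active (Set.toFinite {s : Finset (Fin K) | 1 < #s}).measurableSet
    · refine measurableSet_setOfPred.2 (Measurable.forall fun k => (h k).imp ?_)
      exact measurableSet_setOfPred.1 (measurableSet_le hf.round (hf.pulls k))
  have e : ∀ {β : Type} (g : Memory K → β) (a : α), g (Memory.endRound δ (f a)) =
      if 1 < #(f a).active ∧ ∀ k ∈ (f a).active, (f a).round ≤ (f a).pulls k then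
        g { f a with round := (f a).round + 1, active := Memory.survivors δ (f a) }
      else g (f a) := fun g a => apply_ite g _ _ _
  constructor
  · simp only [e Memory.round]
    exact Measurable.ite hs (hf.round.add_const 1) hf.round
  · simp only [e Memory.active]
    exact Measurable.ite hs (hf.survivors δ) hf.active
  · intro k
    simp only [e fun s => s.pulls k]
    exact Measurable.ite hs (hf.pulls k) (hf.pulls k)
  · intro k
    simp only [e fun s => s.total k]
    exact Measurable.ite hs (hf.total k) (hf.total k)

lemma IsMeas.of_countable {ι : Type*} [Countable ι] [MeasurableSpace ι]
    [MeasurableSingletonClass ι] {f : ι → α → Memory K} (hf : ∀ i, IsMeas (f i)) {g : α → ι}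
    (hg : Measurable g) : IsMeas fun a => f (g a) a := by
  have key : ∀ {β : Type} [MeasurableSpace β] (F : ι → α → β), (∀ i, Measurable (F i)) →
      Measurable fun a => F (g a) a := by
    intro β _ F hF
    have h : Measurable fun p : α × ι => F p.2 p.1 := measurable_from_prod_countable_left hF
    exact h.comp (measurable_id.prodMk hg)
  exact ⟨key (fun i a => (f i a).round) fun i => (hf i).round,
    key (fun i a => (f i a).active) fun i => (hf i).active,
    fun k => key (fun i a => (f i a).pulls k) fun i => (hf i).pulls k,
    fun k => key (fun i a => (f i a).total k) fun i => (hf i).total k⟩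

lemma IsMeas.settle {f : α → Memory K} (hf : IsMeas f) (δ : ℝ) :
    IsMeas fun a => Memory.settle δ (f a) := by
  have h : ∀ n : ℕ, IsMeas fun a => (Memory.endRound δ)^[n] (f a) := by
    intro n
    induction n with
    | zero => exact hf
    | succ n ih => simp only [Function.iterate_succ_apply']; exact ih.endRound δ
  exact IsMeas.of_countable h (Finset.measurable_fun_sum _ fun k _ => hf.pulls k)

lemma IsMeas.record {f : α → Memory K} (hf : IsMeas f) {k : α → Fin K} {x : α → ℝ}
    (hk : Measurable k) (hx : Measurable x) : IsMeas fun a => (f a).record (k a) (x a) := by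
  refine IsMeas.of_countable (f := fun j a => (f a).record j (x a)) (fun j => ⟨?_, ?_, ?_, ?_⟩) hk
  · exact hf.round
  · exact hf.active
  · intro i
    by_cases h : i = j
    · subst h; simpa [Memory.record] using (hf.pulls i).add_const 1
    · simpa [Memory.record, h] using hf.pulls i
  · intro i
    by_cases h : i = j
    · subst h
      simp only [Memory.record, Function.update_self]
      exact (hf.total i).add hx
    · simpa [Memory.record, h] using hf.total i

lemma isMeas_after (δ : ℝ) (t : ℕ) : IsMeas (after (M := M) (K := K) δ t) := by
  have key : ∀ t, ∀ {β : Type} [MeasurableSpace β] (g : β → History M K t), Measurable g →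
      IsMeas fun b => after (M := M) (K := K) δ t (g b) := by
    intro t
    induction t with
    | zero =>
      intro β _ g _
      exact ⟨measurable_const, measurable_const, fun _ => measurable_const,
        fun _ => measurable_const⟩
    | succ t ih =>
      intro β _ g hg
      have hl : Measurable fun b => g b (Fin.last t) := (measurable_pi_apply _).comp hg
      refine ((ih (fun b => Fin.init (g b)) ?_).record hl.snd.fst hl.snd.snd).settle δ
      exact measurable_pi_iff.2 fun i => (measurable_pi_apply i.castSucc).comp hg
  exact key t id measurable_id

lemma IsMeas.decide [NeZero K] {f : α → Memory K} (hf : IsMeas f) (box : Fin K → Fin M) :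
    Measurable fun a => Memory.decide box (f a) := by
  have h : ∀ j, Measurable fun a => j ∈ (f a).active := measurable_finset_iff.1 hf.active
  have hp : Measurable fun a => pending box (f a) := by
    refine measurable_finset_iff.2 fun m => ?_
    simp only [pending, Finset.mem_image, Finset.mem_filter]
    refine Measurable.exists fun k => ((h k).and ?_).and measurable_const
    exact measurableSet_setOfPred.1 (measurableSet_lt (hf.pulls k) hf.round)
  let d : Finset (Fin K) × Finset (Fin M) → Act M K := fun p =>
    if h : 1 < #p.1 ∧ p.2.Nonempty then Sum.inl (p.2.min' h.2)
    else if h : p.1.Nonempty then Sum.inr (p.1.min' h) else Sum.inr 0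
  have hd : Measurable d := fun _ _ => (Set.toFinite _).measurableSet
  exact hd.comp (hf.active.prodMk hp)

end Memory

/-- The Boxed-Bandit Successive Elimination Algorithm, which knows `K`, `M`, `δ` and the arm
sets. -/
def bbsea (box : Fin K → Fin M) [NeZero K] (δ : ℝ) : Policy M K where
  act t := Kernel.deterministic (fun h => Memory.decide box (Memory.after δ t h))
    ((Memory.isMeas_after δ t).decide box)
  markov _ := inferInstance

/-! ### The quantities in the bounds -/

/-- `α_{m,k}` as a function of the gap. -/
def alphaArm (K : ℕ) (δ Δ : ℝ) : ℝ := 1 + 102 / Δ ^ 2 * Real.log (64 * √(8 * K / δ) / Δ ^ 2)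

/-- `β_{m,k}` as a function of the gap and the arm selection probability. -/
def betaArm (K : ℕ) (δ Δ q : ℝ) : ℝ :=
  1 / q * (alphaArm K δ Δ + 2 * Real.log (2 * K / δ) +
    2 * √(Real.log (2 * K / δ) * (Real.log (2 * K / δ) + alphaArm K δ Δ)))

/-- `β_m`, the maximum of `β_{m,k}` over the arms of box `m`, when `b` is the best arm. -/
def Problem.beta (C : Problem box) (b : Fin K) (δ : ℝ) (m : Fin M) : ℝ :=
  ⨆ k : {k : Fin K // box k = m}, betaArm K δ (C.gap b k) (C.q k)

end BoxedBandit

end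

open BoxedBandit

noncomputable section

namespace BoxedBandit

variable {M K : ℕ} {box : Fin K → Fin M}

/-! ### Integration against the law of the process -/

/-! Upper bound. Everything rests on one maximal inequality, `law_exists_le`. If `g` has integral at
most one under every box law, the product of `g` over the observations is a nonnegative
supermartingale whatever the policy does, so it ever reaches `1 / c` with probability at most `c`.
No independent reward stacks or stopping-time arguments are needed: an event such as "arm `k` has
exactly `x` pulls and its rewards deviate" is a set of histories on which such a product is large.
Exponential factors tuned to the sub-Gaussian rewards give `law_rewardSum_le`; factors tuned to the
Bernoulli event that a selection pulls arm `k` give `law_pullCount_le`. Summed over arms, signs and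
numbers of pulls, some confidence interval fails with probability at most `π² δ / 24`; with
probability at least `1 - δ / 2` every arm has enough pulls after `⌊β_m⌋` selections of its box. As
`π² < 12`, the total failure probability is strictly below `δ`.

Off these two events the argument is deterministic (`declares_of_conf`). The best arm is never
eliminated. A suboptimal arm is eliminated once it and the best arm have enough pulls for four radii
to fit into its gap; `threshold` is such a number. A box is selected only if one of its active arms
lags behind the round number, so after `⌊β_m⌋` selections it is never selected again.

Order of the bound. The square root in `betaArm` is dominated by the other terms, and the
assumptions on `D` and `r` let the common logarithm and `1 / Δ²` absorb all constants
(`betaArm_le`).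

Lower bound. Compare the Gaussian instance with one whose means are shifted so that another arm is
best. `lintegral_law_shift` is the change of measure, `integral_lastObs_logRatio` computes the
expected log likelihood ratio as a sum over boxes of expected selections times relative entropy per
selection, and `transportation` bounds it from below through the event that the original best arm
has been declared. One selection of a box reveals arm `k` only with probability `q k`, so shifting
arm `k` alone gives `log (1 / (2.4 δ)) ≤ q_k Δ_k² E[selections of its box]`
(`log_le_mul_tsum_selProb`). Taking the worst arm of each box and adding over the boxes gives the
claim. -/

instance (π : Policy M K) (C : Problem box) : IsProbabilityMeasure (π.law C) := by
  unfold Policy.law; infer_instance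

/-- The states up to time `t`. -/
abbrev Past (M K t : ℕ) : Type := ∀ i : Iic t, State M K (i : ℕ)

/-- The states up to time `t` and the next state, integrated against the law of the process. -/
lemma lintegral_law_succ (π : Policy M K) (C : Problem box) (t : ℕ)
    {G : Past M K t → State M K (t + 1) → ℝ≥0∞}
    (hG : Measurable (Function.uncurry G)) :
    ∫⁻ ω, G (Preorder.frestrictLe t ω) (ω (t + 1)) ∂(π.law C) =
      ∫⁻ ω, ∫⁻ y, G (Preorder.frestrictLe t ω) y ∂(π.step C t (ω t)) ∂(π.law C) := by
  have h := Kernel.map_frestrictLe_trajMeasure_compProd_eq_map_trajMeasure (X := State M K)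
    (μ₀ := Measure.dirac (Sum.inl fun i : Fin 0 => i.elim0))
    (κ := fun t => (π.step C t).comap (fun x => x ⟨t, Finset.mem_Iic.2 le_rfl⟩)
      (measurable_pi_apply _)) (a := t)
  have h1 : ∫⁻ p, Function.uncurry G p ∂((π.law C).map
      (fun x => (Preorder.frestrictLe t x, x (t + 1)))) =
      ∫⁻ ω, G (Preorder.frestrictLe t ω) (ω (t + 1)) ∂(π.law C) :=
    lintegral_map hG (by fun_prop)
  rw [← h1]
  unfold Policy.law at *
  rw [← h, Measure.lintegral_compProd hG, lintegral_map _ (by fun_prop)]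
  · rfl
  · exact hG.lintegral_kernel_prod_right'

lemma lintegral_law_succ_mul (π : Policy M K) (C : Problem box) (t : ℕ)
    {H : Past M K t → ℝ≥0∞} (hH : Measurable H)
    {g : State M K (t + 1) → ℝ≥0∞} (hg : Measurable g) :
    ∫⁻ ω, H (Preorder.frestrictLe t ω) * g (ω (t + 1)) ∂(π.law C) =
      ∫⁻ ω, H (Preorder.frestrictLe t ω) * ∫⁻ y, g y ∂(π.step C t (ω t)) ∂(π.law C) := by
  rw [lintegral_law_succ π C t (G := fun x y => H x * g y) (by fun_prop)]
  simp_rw [lintegral_const_mul _ hg]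

lemma lintegral_law_succ' (π : Policy M K) (C : Problem box) (t : ℕ)
    {g : State M K (t + 1) → ℝ≥0∞} (hg : Measurable g) :
    ∫⁻ ω, g (ω (t + 1)) ∂(π.law C) = ∫⁻ ω, ∫⁻ y, g y ∂(π.step C t (ω t)) ∂(π.law C) := by
  simpa using lintegral_law_succ_mul π C t (H := fun _ => 1) measurable_const hg

lemma lintegral_law_zero (π : Policy M K) (C : Problem box) {g : State M K 0 → ℝ≥0∞}
    (hg : Measurable g) :
    ∫⁻ ω, g (ω 0) ∂(π.law C) = g (Sum.inl fun i : Fin 0 => i.elim0) := by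
  have h : (π.law C).map (Preorder.frestrictLe 0) =
      (Measure.dirac (Sum.inl fun i : Fin 0 => i.elim0)).map
        (MeasurableEquiv.piUnique (fun i : Iic 0 => State M K i)).symm := by
    unfold Policy.law Kernel.trajMeasure
    rw [Measure.map_comp _ _ (by fun_prop), Kernel.traj_map_frestrictLe,
      Kernel.partialTraj_self, Measure.id_comp]
    rfl
  have h1 : ∫⁻ x, g (x ⟨0, Finset.mem_Iic.2 le_rfl⟩) ∂((π.law C).map (Preorder.frestrictLe 0)) =
      ∫⁻ ω, g (ω 0) ∂(π.law C) :=
    lintegral_map (hg.comp (measurable_pi_apply _)) (by fun_prop)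
  have hgm : Measurable fun x : (∀ i : Iic 0, State M K i) =>
      g (x ⟨0, Finset.mem_Iic.2 le_rfl⟩) := hg.comp (measurable_pi_apply _)
  rw [← h1, h]
  refine (lintegral_map hgm (MeasurableEquiv.measurable _)).trans ?_
  exact lintegral_dirac' _ (hgm.comp (MeasurableEquiv.measurable _))

lemma lintegral_boxLaw (C : Problem box) (m : Fin M) {f : Fin K × ℝ → ℝ≥0∞} (hf : Measurable f) :
    ∫⁻ z, f z ∂(C.boxLaw m) =
      ∑ k with box k = m, ENNReal.ofReal (C.q k) * ∫⁻ x, f (k, x) ∂(C.ν k) := by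
  unfold Problem.boxLaw
  rw [lintegral_finsetSum_measure]
  refine Finset.sum_congr rfl fun k _ => ?_
  have := C.prob k
  rw [lintegral_smul_measure, lintegral_prod _ hf.aemeasurable, lintegral_dirac, smul_eq_mul]

lemma lintegral_step_inl (π : Policy M K) (C : Problem box) (t : ℕ) (h : History M K t)
    {g : State M K (t + 1) → ℝ≥0∞} (hg : Measurable g) :
    ∫⁻ y, g y ∂(π.step C t (Sum.inl h)) =
      ∫⁻ a, Sum.elim (fun m => ∫⁻ z, g (Sum.inl (Fin.snoc (α := fun _ => Obs M K) h (m, z)))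
        ∂(C.boxLaw m)) (fun a => g (Sum.inr a)) a ∂(π.act t h) := by
  have := π.markov t
  change ∫⁻ y, g y ∂((C.nextKernel t ∘ₖ (Kernel.id ×ₖ π.act t)) h) = _
  rw [Kernel.lintegral_comp _ _ _ hg, Kernel.prod_apply, Kernel.id_apply, Measure.dirac_prod,
    lintegral_map (hg.lintegral_kernel) (by fun_prop)]
  refine lintegral_congr fun a => ?_
  rcases a with m | a
  · change ∫⁻ y, g y ∂((C.boxLaw m).map fun y =>
      Sum.inl (Fin.snoc (α := fun _ => Obs M K) h (m, y))) = _
    exact lintegral_map hg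
      (measurable_inl.comp ((measurable_snoc t m).comp measurable_prodMk_left))
  · change ∫⁻ y, g y ∂(Measure.dirac (Sum.inr a)) = _
    rw [lintegral_dirac' _ hg]
    rfl

lemma lintegral_step_inr (π : Policy M K) (C : Problem box) (t : ℕ) (a : Fin K)
    {g : State M K (t + 1) → ℝ≥0∞} (hg : Measurable g) :
    ∫⁻ y, g y ∂(π.step C t (Sum.inr a)) = g (Sum.inr a) :=
  lintegral_dirac' _ hg

/-! ### Functions of the last observation -/

/-- The value of `g` at the last observation, and `c` if the policy has stopped or nothing has been
observed. -/
def lastObs {α : Type*} (g : Obs M K → α) (c : α) : ∀ t, State M K t → α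
  | 0, _ => c
  | t + 1, s => Sum.elim (fun h : History M K (t + 1) => g (h (Fin.last t))) (fun _ => c) s

lemma measurable_lastObs {α : Type*} [MeasurableSpace α] {g : Obs M K → α} (hg : Measurable g)
    (c : α) (t : ℕ) : Measurable (lastObs g c t) := by
  cases t with
  | zero => exact measurable_const
  | succ t =>
    exact Measurable.sumElim (hg.comp (measurable_pi_apply _)) measurable_const

/-- The policy uses the same action kernel on both instances, so a comparison of the box laws is all
that is needed for a comparison of one step. The test function `F` in the hypothesis stands for `f`
evaluated at the extended history. -/
lemma lintegral_step_mul_lastObs_congr (π : Policy M K) (C C' : Problem box) (t : ℕ)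
    {g g' : Obs M K → ℝ≥0∞} (hg : Measurable g) (hg' : Measurable g') {c : ℝ≥0∞}
    {f : State M K (t + 1) → ℝ≥0∞} (hf : Measurable f)
    (h : ∀ m, ∀ F : Fin K × ℝ → ℝ≥0∞, Measurable F →
      ∫⁻ z, F z * g (m, z) ∂(C.boxLaw m) = ∫⁻ z, F z * g' (m, z) ∂(C'.boxLaw m))
    (s : State M K t) :
    ∫⁻ y, f y * lastObs g c _ y ∂(π.step C t s) =
      ∫⁻ y, f y * lastObs g' c _ y ∂(π.step C' t s) := by
  have h1 := hf.fun_mul (measurable_lastObs hg c (t + 1))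
  have h2 := hf.fun_mul (measurable_lastObs hg' c (t + 1))
  rcases s with x | a
  · rw [lintegral_step_inl π C t x h1, lintegral_step_inl π C' t x h2]
    congr 1 with a
    rcases a with m | a
    · have hF : Measurable fun z => f (Sum.inl (Fin.snoc (α := fun _ => Obs M K) x (m, z))) :=
        hf.comp (measurable_inl.comp ((measurable_snoc t m).comp measurable_prodMk_left))
      simpa [lastObs] using h m _ hF
    · rfl
  · rw [lintegral_step_inr π C t a h1, lintegral_step_inr π C' t a h2]
    rfl

lemma lintegral_step_lastObs_congr (π : Policy M K) (C : Problem box) (t : ℕ)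
    {g g' : Obs M K → ℝ≥0∞} (hg : Measurable g) (hg' : Measurable g') {c : ℝ≥0∞}
    (h : ∀ m, ∫⁻ z, g (m, z) ∂(C.boxLaw m) = ∫⁻ z, g' (m, z) ∂(C.boxLaw m))
    (s : State M K t) :
    ∫⁻ y, lastObs g c _ y ∂(π.step C t s) = ∫⁻ y, lastObs g' c _ y ∂(π.step C t s) := by
  have h1 := measurable_lastObs hg c (t + 1)
  have h2 := measurable_lastObs hg' c (t + 1)
  rcases s with x | a
  · rw [lintegral_step_inl π C t x h1, lintegral_step_inl π C t x h2]
    congr 1 with a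
    rcases a with m | a
    · simpa [lastObs] using h m
    · rfl
  · rw [lintegral_step_inr π C t a h1, lintegral_step_inr π C t a h2]
    rfl

/-- This serves to replace a function of the observation by its conditional mean given the selected
box. -/
lemma lintegral_law_lastObs_congr (π : Policy M K) (C : Problem box) (t : ℕ)
    {g g' : Obs M K → ℝ≥0∞} (hg : Measurable g) (hg' : Measurable g') {c : ℝ≥0∞}
    (h : ∀ m, ∫⁻ z, g (m, z) ∂(C.boxLaw m) = ∫⁻ z, g' (m, z) ∂(C.boxLaw m)) :
    ∫⁻ ω, lastObs g c (t + 1) (ω (t + 1)) ∂(π.law C) =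
      ∫⁻ ω, lastObs g' c (t + 1) (ω (t + 1)) ∂(π.law C) := by
  rw [lintegral_law_succ' π C t (measurable_lastObs hg c _),
    lintegral_law_succ' π C t (measurable_lastObs hg' c _)]
  simp_rw [lintegral_step_lastObs_congr π C t hg hg' h]

/-! ### Almost sure structure of the trajectories -/

/-- Almost sure properties of the trajectory are obtained by checking each possible present state
separately. -/
lemma ae_step (π : Policy M K) (C : Problem box) (t : ℕ) {p : State M K t → State M K (t + 1) → Prop}
    (hp : MeasurableSet {x : State M K t × State M K (t + 1) | p x.1 x.2})
    (h : ∀ s, ∫⁻ y, {y | ¬ p s y}.indicator 1 y ∂(π.step C t s) = 0) :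
    ∀ᵐ ω ∂(π.law C), p (ω t) (ω (t + 1)) := by
  classical
  let G : Past M K t → State M K (t + 1) → ℝ≥0∞ := fun x y =>
    {z : State M K t × State M K (t + 1) | ¬ p z.1 z.2}.indicator 1
      (x ⟨t, Finset.mem_Iic.2 le_rfl⟩, y)
  have hm : Measurable ({z : State M K t × State M K (t + 1) | ¬ p z.1 z.2}.indicator
      (1 : State M K t × State M K (t + 1) → ℝ≥0∞)) := measurable_one.indicator hp.compl
  have hG : Measurable (Function.uncurry G) :=
    hm.comp (((measurable_pi_apply _).comp measurable_fst).prodMk measurable_snd)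
  have h1 := lintegral_law_succ π C t hG
  have h2 : ∀ ω : Traj M K, ∫⁻ y, G (Preorder.frestrictLe t ω) y ∂(π.step C t (ω t)) = 0 :=
    fun ω => h (ω t)
  simp_rw [h2, lintegral_zero] at h1
  have hm' : Measurable fun ω : Traj M K => G (Preorder.frestrictLe t ω) (ω (t + 1)) :=
    hG.comp (by fun_prop : Measurable fun ω : Traj M K => (Preorder.frestrictLe t ω, ω (t + 1)))
  filter_upwards [(lintegral_eq_zero_iff hm').1 h1] with ω hω
  by_contra hc
  have : ({z : State M K t × State M K (t + 1) | ¬ p z.1 z.2}.indicator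
      (1 : State M K t × State M K (t + 1) → ℝ≥0∞))
      (ω t, ω (t + 1)) = 0 := hω
  rw [Set.indicator_of_mem hc] at this
  exact one_ne_zero this

lemma ae_zero (π : Policy M K) (C : Problem box) : ∀ᵐ ω ∂(π.law C), (ω 0).isLeft := by
  have hm : Measurable (Sum.elim (fun _ => 0) (fun _ => 1) : State M K 0 → ℝ≥0∞) :=
    Measurable.sumElim measurable_const measurable_const
  have h := lintegral_law_zero π C hm
  have hm' : Measurable fun ω : Traj M K =>
      (Sum.elim (fun _ => 0) (fun _ => 1) : State M K 0 → ℝ≥0∞) (ω 0) :=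
    hm.comp (measurable_pi_apply _)
  filter_upwards [(lintegral_eq_zero_iff hm').1 h] with ω hω
  rcases hs : ω 0 with x | a
  · rfl
  · simp [hs] at hω

/-- A possible transition: an observation is appended to the history, or the policy stops, or it has
stopped before. -/
def Transition (box : Fin K → Fin M) (t : ℕ) :
    State M K t → State M K (t + 1) → Prop
  | .inl h, .inl h' => Fin.init h' = h ∧ box (h' (Fin.last t)).2.1 = (h' (Fin.last t)).1
  | .inl _, .inr _ => True
  | .inr _, .inl _ => False
  | .inr a, .inr a' => a' = a

lemma measurableSet_sum_prod {α β γ δ : Type*} [MeasurableSpace α] [MeasurableSpace β]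
    [MeasurableSpace γ] [MeasurableSpace δ] {p : α ⊕ β → γ ⊕ δ → Prop}
    (h1 : MeasurableSet {x : α × γ | p (.inl x.1) (.inl x.2)})
    (h2 : MeasurableSet {x : α × δ | p (.inl x.1) (.inr x.2)})
    (h3 : MeasurableSet {x : β × γ | p (.inr x.1) (.inl x.2)})
    (h4 : MeasurableSet {x : β × δ | p (.inr x.1) (.inr x.2)}) :
    MeasurableSet {x : (α ⊕ β) × (γ ⊕ δ) | p x.1 x.2} := by
  have e : {x : (α ⊕ β) × (γ ⊕ δ) | p x.1 x.2} =
      (Prod.map Sum.inl Sum.inl '' {x : α × γ | p (.inl x.1) (.inl x.2)}) ∪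
      (Prod.map Sum.inl Sum.inr '' {x : α × δ | p (.inl x.1) (.inr x.2)}) ∪
      (Prod.map Sum.inr Sum.inl '' {x : β × γ | p (.inr x.1) (.inl x.2)}) ∪
      (Prod.map Sum.inr Sum.inr '' {x : β × δ | p (.inr x.1) (.inr x.2)}) := by
    ext ⟨a | a, b | b⟩ <;> simp
  rw [e]
  have hl : MeasurableEmbedding (Sum.inl : α → α ⊕ β) :=
    ⟨Sum.inl_injective, measurable_inl, fun _ h => h.inl_image⟩
  have hr : MeasurableEmbedding (Sum.inr : β → α ⊕ β) :=
    ⟨Sum.inr_injective, measurable_inr, fun _ h => h.inr_image⟩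
  have hl' : MeasurableEmbedding (Sum.inl : γ → γ ⊕ δ) :=
    ⟨Sum.inl_injective, measurable_inl, fun _ h => h.inl_image⟩
  have hr' : MeasurableEmbedding (Sum.inr : δ → γ ⊕ δ) :=
    ⟨Sum.inr_injective, measurable_inr, fun _ h => h.inr_image⟩
  exact ((((hl.prodMap hl').measurableSet_image.2 h1).union
    ((hl.prodMap hr').measurableSet_image.2 h2)).union
    ((hr.prodMap hl').measurableSet_image.2 h3)).union
    ((hr.prodMap hr').measurableSet_image.2 h4)

lemma measurable_init (t : ℕ) :
    Measurable fun h : History M K (t + 1) => (Fin.init h : History M K t) :=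
  measurable_pi_iff.2 fun i => measurable_pi_apply i.castSucc

lemma measurableSet_transition (t : ℕ) :
    MeasurableSet {x : State M K t × State M K (t + 1) | Transition box t x.1 x.2} := by
  refine measurableSet_sum_prod ?_ ?_ ?_ ?_
  · refine MeasurableSet.inter ?_ ?_
    · exact measurableSet_eq_fun ((measurable_init t).comp measurable_snd) measurable_fst
    · have hl : Measurable fun x : History M K t × History M K (t + 1) => x.2 (Fin.last t) :=
        (measurable_pi_apply _).comp measurable_snd
      exact measurableSet_eq_fun ((measurable_of_finite box).comp hl.snd.fst) hl.fst
  · exact MeasurableSet.univ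
  · exact MeasurableSet.empty
  · exact measurableSet_eq_fun measurable_snd measurable_fst

lemma ae_boxLaw (C : Problem box) (m : Fin M) : ∀ᵐ z ∂(C.boxLaw m), box z.1 = m := by
  have hm : Measurable fun z : Fin K × ℝ => if box z.1 = m then (0 : ℝ≥0∞) else 1 :=
    (measurable_of_finite fun k => if box k = m then (0 : ℝ≥0∞) else 1).comp measurable_fst
  have h : ∫⁻ z, (if box z.1 = m then (0 : ℝ≥0∞) else 1) ∂(C.boxLaw m) = 0 := by
    rw [lintegral_boxLaw C m hm]
    refine Finset.sum_eq_zero fun k hk => ?_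
    simp [(Finset.mem_filter.1 hk).2]
  rw [lintegral_eq_zero_iff hm] at h
  filter_upwards [h] with z hz
  by_contra hc
  simp [hc] at hz

lemma ae_transition (π : Policy M K) (C : Problem box) :
    ∀ᵐ ω ∂(π.law C), ∀ t, Transition box t (ω t) (ω (t + 1)) := by
  refine ae_all_iff.2 fun t => ae_step π C t (measurableSet_transition t) fun s => ?_
  have hm : Measurable ({y | ¬ Transition box t s y}.indicator (1 : State M K (t + 1) → ℝ≥0∞)) :=
    measurable_one.indicator (measurable_prodMk_left (measurableSet_transition t).compl)
  rcases s with h | a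
  · rw [lintegral_step_inl π C t h hm]
    refine lintegral_eq_zero_of_ae_eq_zero (.of_forall fun a => ?_)
    rcases a with m | a
    · refine lintegral_eq_zero_of_ae_eq_zero ?_
      filter_upwards [ae_boxLaw C m] with z hz
      refine Set.indicator_of_notMem ?_ _
      simp [Transition, hz]
    · simp [Transition]
  · rw [lintegral_step_inr π C t a hm]
    simp [Transition]

/-! ### A maximal inequality for product supermartingales -/

/-- Ville's inequality for nonnegative supermartingales of product form. -/
lemma law_exists_le (π : Policy M K) (C : Problem box) {g : Obs M K → ℝ≥0∞} (hg : Measurable g)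
    (hg1 : ∀ m, ∫⁻ z, g (m, z) ∂(C.boxLaw m) ≤ 1) (c : ℝ≥0∞) (A : ∀ t, Set (History M K t))
    (hA : ∀ t, MeasurableSet (A t)) (hc : ∀ t, ∀ h ∈ A t, 1 ≤ c * ∏ i, g (h i)) :
    π.law C {ω | ∃ t, ∃ h ∈ A t, ω t = Sum.inl h} ≤ c := by
  classical
  -- The value after stopping may be set to zero: this only lowers the supermartingale, and the
  -- event concerns running histories alone.
  let F : ∀ t, State M K t → ℝ≥0∞ := fun t => Sum.elim (fun h => c * ∏ i, g (h i)) (fun _ => 0)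
  have hF : ∀ t, Measurable (F t) := fun t => Measurable.sumElim
    (Measurable.const_mul (Finset.measurable_prod _ fun i _ => hg.comp (measurable_pi_apply i)) c)
    measurable_const
  have hstep : ∀ t s, ∫⁻ y, F (t + 1) y ∂(π.step C t s) ≤ F t s := by
    have := π.markov
    rintro t (h | a)
    · rw [lintegral_step_inl π C t h (hF _)]
      calc _ ≤ ∫⁻ _, c * ∏ i, g (h i) ∂(π.act t h) := by
            refine lintegral_mono fun a => ?_
            rcases a with m | a
            · have hgm : Measurable fun z => g (m, z) := hg.comp measurable_prodMk_left
              simp only [F, Sum.elim_inl, Fin.prod_univ_castSucc, Fin.snoc_castSucc, Fin.snoc_last]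
              simp_rw [← mul_assoc]
              rw [lintegral_const_mul _ hgm]
              exact mul_le_of_le_one_right' (hg1 m)
            · simp [F]
        _ = _ := by simp [F]
    · rw [lintegral_step_inr π C t a (hF _)]
      simp [F]
  let B : ∀ t, Set (State M K t) := fun t => Sum.inl '' A t
  have hB : ∀ t, MeasurableSet (B t) := fun t => (hA t).inl_image
  have hFB : ∀ t, ∀ s ∈ B t, 1 ≤ F t s := by
    rintro t _ ⟨h, hh, rfl⟩
    exact hc t h hh
  let hit : ∀ t, Set (Past M K t) := fun t => 
    ⋃ i : Iic t, (fun x : Past M K t => x i) ⁻¹' B (i : ℕ)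
  have hhit : ∀ t, MeasurableSet (hit t) := fun t =>
    MeasurableSet.iUnion fun i => measurable_pi_apply (X := fun i : Iic t => State M K (i : ℕ)) i (hB i)
  -- The supermartingale frozen at the value one from the first hit on. Its expectation dominates
  -- the probability of a hit by time `t`.
  let V : ∀ t, Past M K t → ℝ≥0∞ := fun t x =>
    if x ∈ hit t then 1 else F t (x ⟨t, Finset.mem_Iic.2 le_rfl⟩)
  have hmono : ∀ t, ∫⁻ ω, V (t + 1) (Preorder.frestrictLe (t + 1) ω) ∂(π.law C) ≤
      ∫⁻ ω, V t (Preorder.frestrictLe t ω) ∂(π.law C) := by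
    intro t
    -- `G` freezes only the paths that have hit by time `t`. On a path that first hits at time `t +
    -- 1`, the value `F (t + 1)` is already at least one, so freezing there does not increase it.
    let G : Past M K t → State M K (t + 1) → ℝ≥0∞ := fun x y =>
      if x ∈ hit t then 1 else F (t + 1) y
    have hG : Measurable (Function.uncurry G) :=
      Measurable.ite (measurable_fst (hhit t)) measurable_const ((hF _).comp measurable_snd)
    calc _ ≤ ∫⁻ ω, G (Preorder.frestrictLe t ω) (ω (t + 1)) ∂(π.law C) := by
          refine lintegral_mono fun ω => ?_
          simp only [V, G]
          by_cases h1 : Preorder.frestrictLe t ω ∈ hit t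
          · have h2 : Preorder.frestrictLe (t + 1) ω ∈ hit (t + 1) := by
              obtain ⟨i, hi⟩ := Set.mem_iUnion.1 h1
              exact Set.mem_iUnion.2
                ⟨⟨i, Finset.mem_Iic.2 ((Finset.mem_Iic.1 i.2).trans (Nat.le_succ t))⟩, hi⟩
            rw [if_pos h1, if_pos h2]
          · rw [if_neg h1]
            split_ifs with h2
            · obtain ⟨⟨i, hi'⟩, hi⟩ := Set.mem_iUnion.1 h2
              rcases (Finset.mem_Iic.1 hi').lt_or_eq with hlt | rfl
              · exact absurd (Set.mem_iUnion.2
                  ⟨⟨i, Finset.mem_Iic.2 (Nat.lt_succ_iff.1 hlt)⟩, hi⟩) h1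
              · exact hFB _ _ hi
            · exact le_rfl
      _ = ∫⁻ ω, ∫⁻ y, G (Preorder.frestrictLe t ω) y ∂(π.step C t (ω t)) ∂(π.law C) :=
          lintegral_law_succ π C t hG
      _ ≤ _ := by
          refine lintegral_mono fun ω => ?_
          simp only [V, G]
          split_ifs with h1
          · simp
          · exact hstep t (ω t)
  have hV : ∀ t, ∫⁻ ω, V t (Preorder.frestrictLe t ω) ∂(π.law C) ≤ c := by
    intro t
    induction t with
    | zero =>
      calc _ ≤ ∫⁻ ω, F 0 (ω 0) ∂(π.law C) := by
            refine lintegral_mono fun ω => ?_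
            simp only [V]
            split_ifs with h
            · obtain ⟨⟨i, hi'⟩, hi⟩ := Set.mem_iUnion.1 h
              obtain rfl := Nat.le_zero.1 (Finset.mem_Iic.1 hi')
              exact hFB _ _ hi
            · exact le_rfl
        _ = c := by rw [lintegral_law_zero π C (hF 0)]; simp [F]
    | succ t ih => exact (hmono t).trans ih
  have hU : {ω : Traj M K | ∃ t, ∃ h ∈ A t, ω t = Sum.inl h} =
      ⋃ t, {ω : Traj M K | Preorder.frestrictLe t ω ∈ hit t} := by
    ext ω
    simp only [Set.mem_ofPred_eq, Set.mem_iUnion]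
    constructor
    · rintro ⟨t, h, hh, he⟩
      exact ⟨t, Set.mem_iUnion.2 ⟨⟨t, Finset.mem_Iic.2 le_rfl⟩, h, hh, he.symm⟩⟩
    · rintro ⟨t, ht⟩
      obtain ⟨⟨i, hi'⟩, h, hh, he⟩ := Set.mem_iUnion.1 ht
      exact ⟨i, h, hh, he.symm⟩
  have hmonoU : Monotone fun t => {ω : Traj M K | Preorder.frestrictLe t ω ∈ hit t} := by
    intro s t hst ω hω
    obtain ⟨i, hi⟩ := Set.mem_iUnion.1 hω
    exact Set.mem_iUnion.2 ⟨⟨i, Finset.mem_Iic.2 ((Finset.mem_Iic.1 i.2).trans hst)⟩, hi⟩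
  rw [hU, hmonoU.measure_iUnion]
  refine iSup_le fun t => ?_
  have hS : MeasurableSet {ω : Traj M K | Preorder.frestrictLe t ω ∈ hit t} :=
    (by fun_prop : Measurable fun ω : Traj M K => Preorder.frestrictLe t ω) (hhit t)
  rw [← lintegral_indicator_one hS]
  refine le_trans (lintegral_mono fun ω => ?_) (hV t)
  by_cases h : Preorder.frestrictLe t ω ∈ hit t
  · rw [Set.indicator_of_mem (by exact h)]
    simp only [V, if_pos h]
    exact le_rfl
  · rw [Set.indicator_of_notMem (by exact h)]
    exact zero_le

/-! ### Concentration of the rewards and of the numbers of pulls -/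

/-- The number of pulls of arm `k`. -/
def pullCount (k : Fin K) {t : ℕ} (h : History M K t) : ℕ :=
  ∑ i, if (h i).2.1 = k then 1 else 0

/-- The sum of the rewards of arm `k`. -/
def rewardSum (k : Fin K) {t : ℕ} (h : History M K t) : ℝ :=
  ∑ i, if (h i).2.1 = k then (h i).2.2 else 0

/-- The number of selections of box `m`. -/
def selCount (m : Fin M) {t : ℕ} (h : History M K t) : ℕ :=
  ∑ i, if (h i).1 = m then 1 else 0

lemma measurable_pullCount (k : Fin K) (t : ℕ) :
    Measurable fun h : History M K t => pullCount k h := by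
  refine Finset.measurable_fun_sum _ fun i _ => ?_
  exact (measurable_of_finite fun j : Fin K => if j = k then 1 else 0).comp
    (measurable_pi_apply i).snd.fst

lemma measurable_selCount (m : Fin M) (t : ℕ) :
    Measurable fun h : History M K t => selCount m h := by
  refine Finset.measurable_fun_sum _ fun i _ => ?_
  exact (measurable_of_finite fun j : Fin M => if j = m then 1 else 0).comp
    (measurable_pi_apply i).fst

lemma measurable_rewardSum (k : Fin K) (t : ℕ) :
    Measurable fun h : History M K t => rewardSum k h := by
  refine Finset.measurable_fun_sum _ fun i _ => ?_
  have hi : Measurable fun h : History M K t => h i := measurable_pi_apply i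
  exact Measurable.ite (hi.snd.fst (MeasurableSet.singleton k)) hi.snd.snd measurable_const

lemma law_exists_le_exp (π : Policy M K) (C : Problem box) {φ : Obs M K → ℝ} (hφ : Measurable φ)
    (hφ1 : ∀ m, ∫⁻ z, ENNReal.ofReal (Real.exp (φ (m, z))) ∂(C.boxLaw m) ≤ 1) (B : ℝ)
    (A : ∀ t, Set (History M K t)) (hA : ∀ t, MeasurableSet (A t))
    (hB : ∀ t, ∀ h ∈ A t, B ≤ ∑ i, φ (h i)) :
    π.law C {ω | ∃ t, ∃ h ∈ A t, ω t = Sum.inl h} ≤ ENNReal.ofReal (Real.exp (-B)) := by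
  refine law_exists_le π C (g := fun o => ENNReal.ofReal (Real.exp (φ o))) (by fun_prop) hφ1 _ A hA
    fun t h hh => ?_
  rw [← ENNReal.ofReal_prod_of_nonneg fun i _ => (Real.exp_pos _).le, ← Real.exp_sum,
    ← ENNReal.ofReal_mul (Real.exp_pos _).le, ← Real.exp_add, ← ENNReal.ofReal_one]
  refine ENNReal.ofReal_le_ofReal (Real.one_le_exp ?_)
  linarith [hB t h hh]

lemma lintegral_boxLaw_le_one (C : Problem box) (m : Fin M) {f : Fin K × ℝ → ℝ≥0∞}
    (hf : Measurable f) (h : ∀ k, ∫⁻ x, f (k, x) ∂(C.ν k) ≤ 1) : ∫⁻ z, f z ∂(C.boxLaw m) ≤ 1 := by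
  rw [lintegral_boxLaw C m hf]
  calc _ ≤ ∑ k with box k = m, ENNReal.ofReal (C.q k) :=
        Finset.sum_le_sum fun k _ => mul_le_of_le_one_right' (h k)
    _ = 1 := by
        rw [← ENNReal.ofReal_sum_of_nonneg (fun k _ => (C.q_pos k).le), C.q_sum, ENNReal.ofReal_one]

/-- The term `l ^ 2 / 2` compensates exactly for the sub-Gaussian bound on the moment generating
function. -/
lemma lintegral_exp_le_one (C : Problem box) (k : Fin K) (l : ℝ) :
    ∫⁻ x, ENNReal.ofReal (Real.exp (l * (x - C.mean k) - l ^ 2 / 2)) ∂(C.ν k) ≤ 1 := by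
  have h := C.subGaussian k
  have h1 := h.integrable_exp_mul l
  have h2 := h.mgf_le l
  have e : ∀ x, Real.exp (l * (x - C.mean k) - l ^ 2 / 2) =
      Real.exp (l * (x - ∫ y, y ∂(C.ν k))) * Real.exp (-(l ^ 2 / 2)) := fun x => by
    rw [← Real.exp_add]; rfl
  simp_rw [e]
  rw [← ofReal_integral_eq_lintegral_ofReal (h1.mul_const _)
    (.of_forall fun x => by positivity), integral_mul_const, ← ENNReal.ofReal_one]
  refine ENNReal.ofReal_le_ofReal ?_
  rw [Real.exp_neg, ← div_eq_mul_inv, div_le_one (Real.exp_pos _)]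
  simpa [mgf] using h2

/-- The sum of the first `x` rewards of an arm deviates from its mean with small probability. -/
lemma law_rewardSum_le (π : Policy M K) (C : Problem box) (k : Fin K) (x : ℕ) (l : ℝ) :
    π.law C {ω | ∃ t, ∃ h ∈ {h : History M K t | pullCount k h = x ∧
      x * l ^ 2 ≤ l * (rewardSum k h - x * C.mean k)}, ω t = Sum.inl h} ≤
      ENNReal.ofReal (Real.exp (-(x * l ^ 2 / 2))) := by
  -- Observations of other arms contribute the factor one, so after exactly `x` pulls the
  -- accumulated compensator is `x * l ^ 2 / 2`, however the pulls are spread over time.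
  let φ : Obs M K → ℝ := fun o => if o.2.1 = k then l * (o.2.2 - C.mean k) - l ^ 2 / 2 else 0
  have hφ : Measurable φ := by
    have h1 : MeasurableSet {o : Obs M K | o.2.1 = k} :=
      measurable_snd.fst (MeasurableSet.singleton k)
    exact Measurable.ite h1 (by fun_prop) measurable_const
  refine law_exists_le_exp π C hφ (fun m => ?_) _ _ (fun t => ?_) fun t h hh => ?_
  · refine lintegral_boxLaw_le_one C m (by fun_prop) fun j => ?_
    have := C.prob j
    by_cases hj : j = k
    · subst hj
      simpa [φ] using lintegral_exp_le_one C j l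
    · simp [φ, hj]
  · have h1 := measurable_pullCount (M := M) k t
    have h2 := measurable_rewardSum (M := M) k t
    exact (h1 (MeasurableSet.singleton x)).inter (measurableSet_le measurable_const
      ((h2.sub_const _).const_mul l))
  · obtain ⟨hx, hl⟩ := hh
    have hs : ∑ i, φ (h i) =
        l * (rewardSum k h - pullCount k h * C.mean k) - pullCount k h * (l ^ 2 / 2) := by
      simp only [φ, rewardSum, pullCount, Nat.cast_sum, Finset.sum_mul, Finset.mul_sum,
        ← Finset.sum_sub_distrib]
      refine Finset.sum_congr rfl fun i _ => ?_
      split_ifs <;> simp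
    rw [hs, hx]
    linarith

/-- Few pulls of an arm among the first `N` selections of its box have small probability. -/
lemma law_pullCount_le (π : Policy M K) (C : Problem box) (k : Fin K) (N a : ℕ) {θ : ℝ}
    (hθ : 0 ≤ θ) :
    π.law C {ω | ∃ t, ∃ h ∈ {h : History M K t | selCount (box k) h = N ∧ pullCount k h ≤ a},
      ω t = Sum.inl h} ≤
      ENNReal.ofReal (Real.exp (-(N * C.q k * (1 - Real.exp (-θ)) - θ * a))) := by
  set u : ℝ := C.q k * (1 - Real.exp (-θ)) with hu
  -- The factor of a selection of the box has mean `exp u * (1 - u)`, as `1 - u` is the mean of `exp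
  -- (-θ)` to the power of the pull indicator. This is at most one because `1 - u ≤ exp (-u)`.
  let φ : Obs M K → ℝ := fun o => if o.1 = box k then u - (if o.2.1 = k then θ else 0) else 0
  have hφ : Measurable φ := by
    have : φ = (fun p : Fin M × Fin K =>
        if p.1 = box k then u - (if p.2 = k then θ else 0) else 0) ∘ fun o => (o.1, o.2.1) := rfl
    rw [this]
    exact (measurable_of_finite _).comp (by fun_prop)
  refine law_exists_le_exp π C hφ (fun m => ?_) _ _ (fun t => ?_) fun t h hh => ?_
  · by_cases hm : m = box k
    · subst hm
      rw [lintegral_boxLaw C _ (by fun_prop)]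
      have e : ∀ j, ENNReal.ofReal (C.q j) *
          ∫⁻ x, ENNReal.ofReal (Real.exp (φ (box k, j, x))) ∂(C.ν j) =
          ENNReal.ofReal (C.q j * Real.exp (u - if j = k then θ else 0)) := fun j => by
        have := C.prob
        rw [ENNReal.ofReal_mul (C.q_pos j).le]
        by_cases hj : j = k <;> simp [φ, hj]
      simp_rw [e]
      rw [← ENNReal.ofReal_sum_of_nonneg
        (fun j _ => mul_nonneg (C.q_pos j).le (Real.exp_pos _).le), ← ENNReal.ofReal_one]
      refine ENNReal.ofReal_le_ofReal ?_
      have e2 : ∀ j, C.q j * Real.exp (u - if j = k then θ else 0) =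
          Real.exp u * (C.q j - if j = k then u else 0) := fun j => by
        split_ifs with hj
        · subst hj
          rw [sub_eq_add_neg, Real.exp_add, hu]; ring
        · simp [mul_comm]
      simp_rw [e2]
      rw [← Finset.mul_sum, Finset.sum_sub_distrib, C.q_sum, Finset.sum_ite_eq' _ k,
        if_pos (by simp)]
      have h1 : 1 - u ≤ Real.exp (-u) := by linarith [Real.add_one_le_exp (-u)]
      calc Real.exp u * (1 - u) ≤ Real.exp u * Real.exp (-u) := by gcongr
        _ = 1 := by rw [← Real.exp_add]; simp
    · simp [φ, hm]
  · have h1 := measurable_pullCount (M := M) k t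
    have h2 := measurable_selCount (K := K) (box k) t
    exact (h2 (MeasurableSet.singleton N)).inter (measurableSet_le h1 measurable_const)
  · obtain ⟨hN, ha⟩ := hh
    have hs : selCount (box k) h * u - θ * pullCount k h ≤ ∑ i, φ (h i) := by
      simp only [φ, selCount, pullCount, Nat.cast_sum, Finset.sum_mul, Finset.mul_sum,
        ← Finset.sum_sub_distrib]
      refine Finset.sum_le_sum fun i _ => ?_
      split_ifs <;> simp [hθ]
    have h3 : θ * pullCount k h ≤ θ * a := mul_le_mul_of_nonneg_left (by exact_mod_cast ha) hθ
    rw [hN] at hs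
    have : (N : ℝ) * C.q k * (1 - Real.exp (-θ)) = N * u := by rw [hu]; ring
    linarith

/-! ### Real inequalities for the two bounds -/

/-- Holds since `(1 + θ + θ² / 2) (1 - θ + θ² / 2) = 1 + θ⁴ / 4 ≥ 1`, and the first factor is at
most `exp θ`. -/
lemma exp_neg_le {θ : ℝ} (hθ : 0 ≤ θ) : Real.exp (-θ) ≤ 1 - θ + θ ^ 2 / 2 := by
  have h1 := Real.quadratic_le_exp_of_nonneg hθ
  have h2 : Real.exp θ * Real.exp (-θ) = 1 := by rw [← Real.exp_add]; simp
  have h3 := Real.exp_pos (-θ)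
  have h4 : (1 + θ + θ ^ 2 / 2) * Real.exp (-θ) ≤ 1 := (mul_le_mul_of_nonneg_right h1 h3.le).trans_eq h2
  have h5 : 1 ≤ (1 + θ + θ ^ 2 / 2) * (1 - θ + θ ^ 2 / 2) := by nlinarith [sq_nonneg (θ ^ 2)]
  by_contra hc
  push Not at hc
  have h6 : 0 < 1 + θ + θ ^ 2 / 2 := by positivity
  nlinarith [mul_lt_mul_of_pos_left hc h6]

/-- A lower bound for the optimised Chernoff exponent. -/
lemma exists_chernoff {μ a L : ℝ} (ha : 0 ≤ a) (hL : 0 < L) (h : a + L + √(L ^ 2 + 2 * a * L) ≤ μ) :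
    ∃ θ : ℝ, 0 ≤ θ ∧ L ≤ μ * (1 - Real.exp (-θ)) - θ * a := by
  have hs := Real.sqrt_nonneg (L ^ 2 + 2 * a * L)
  have hs2 := Real.sq_sqrt (by positivity : 0 ≤ L ^ 2 + 2 * a * L)
  have hμ : 0 < μ := by linarith
  -- The hypothesis says that `μ - a` is at least the larger root of `y² - 2 L y - 2 a L`.
  have hq : 2 * μ * L ≤ (μ - a) ^ 2 := by
    nlinarith [mul_self_le_mul_self hs (by linarith : √(L ^ 2 + 2 * a * L) ≤ μ - a - L)]
  have hθ : 0 ≤ (μ - a) / μ := div_nonneg (by linarith) hμ.le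
  -- This `θ` maximises `μ (θ - θ² / 2) - θ a`, the exponent after `exp (-θ)` is replaced by its
  -- quadratic bound.
  refine ⟨(μ - a) / μ, hθ, ?_⟩
  have h1 := exp_neg_le hθ
  have h2 : μ * ((μ - a) / μ - ((μ - a) / μ) ^ 2 / 2) - (μ - a) / μ * a =
      (μ - a) ^ 2 / (2 * μ) := by field_simp; ring
  have h3 : L ≤ (μ - a) ^ 2 / (2 * μ) := by rw [le_div_iff₀ (by positivity)]; linarith
  nlinarith [mul_le_mul_of_nonneg_left h1 hμ.le]

/-! ### The confidence radius and the number of rounds -/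

/-- With `v = x / A`, the claim is `log (c A) + log v < v`. The hypothesis bounds the first term by
`32 v / 51`; the tangent of `log` at `51 / 19` bounds the second by less than `19 v / 51`, because
`51 / 19 < e`. The constant 102 of the theorem enters here. -/
lemma mul_log_lt {c A x : ℝ} (hc : 0 < c) (hA : 0 < A) (hx : 0 < x)
    (h : 102 / 64 * A * Real.log (c * A) ≤ x) : A * Real.log (c * x) < x := by
  have hv : 0 < x / A := div_pos hx hA
  have e1 : Real.log (c * x) = Real.log (c * A) + Real.log (x / A) := by
    rw [← Real.log_mul (by positivity) hv.ne']; congr 1; field_simp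
  have h1 : Real.log (51 / 19) < 1 := by
    rw [Real.log_lt_iff_lt_exp (by norm_num)]
    linarith [Real.exp_one_gt_d9]
  have h2 : Real.log (x / A) ≤ Real.log (51 / 19) + (x / A) * (19 / 51) - 1 := by
    have h3 := Real.log_le_sub_one_of_pos (show 0 < (x / A) * (19 / 51) by positivity)
    have h4 : Real.log (x / A) = Real.log (51 / 19) + Real.log ((x / A) * (19 / 51)) := by
      rw [← Real.log_mul (by norm_num) (by positivity)]; congr 1; ring
    linarith
  have h5 : Real.log (c * A) ≤ 64 / 102 * (x / A) := by
    rw [← mul_div_assoc, le_div_iff₀ hA]; linarith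
  have h6 : Real.log (c * x) < x / A := by rw [e1]; linarith
  calc A * Real.log (c * x) < A * (x / A) := by gcongr
    _ = x := by field_simp

/-- The number of pulls of an arm with gap `Δ` that suffices for its elimination. -/
def threshold (K : ℕ) (δ Δ : ℝ) : ℕ :=
  max 1 ⌈102 / Δ ^ 2 * Real.log (64 * √(8 * K / δ) / Δ ^ 2)⌉₊

lemma log_pos_of_params {δ : ℝ} (hK : 2 ≤ K) (hδ : 0 < δ) (hδ1 : δ < 1) {x : ℕ} (hx : 1 ≤ x) :
    0 < Real.log (8 * K * (x : ℝ) ^ 2 / δ) := by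
  have hK' : (2 : ℝ) ≤ K := by exact_mod_cast hK
  have hx' : (1 : ℝ) ≤ x := by exact_mod_cast hx
  refine Real.log_pos ?_
  rw [lt_div_iff₀ hδ]
  nlinarith [one_le_pow₀ hx' (n := 2)]

lemma radius_pos {δ : ℝ} (hK : 2 ≤ K) (hδ : 0 < δ) (hδ1 : δ < 1) {x : ℕ} (hx : 1 ≤ x) :
    0 < radius K δ x := by
  have hx' : (0 : ℝ) < x := by exact_mod_cast hx
  have := log_pos_of_params hK hδ hδ1 hx
  exact Real.sqrt_pos.2 (by positivity)

/-- With `c = √(8 K / δ)` the radius squared is `4 log (c x) / x`, so the claim is the inequality of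
`mul_log_lt` for `A = 64 / Δ²`. -/
lemma four_mul_radius_lt {δ Δ : ℝ} (hK : 2 ≤ K) (hδ : 0 < δ) (hΔ : 0 < Δ) {x : ℕ}
    (hx : threshold K δ Δ ≤ x) : 4 * radius K δ x < Δ := by
  have hx1 : 1 ≤ x := (le_max_left _ _).trans hx
  have hxr : (0 : ℝ) < x := by exact_mod_cast hx1
  have hK' : (0 : ℝ) < K := by exact_mod_cast (by omega : 0 < K)
  set c := √(8 * K / δ) with hc
  have hc0 : 0 < c := Real.sqrt_pos.2 (by positivity)
  have hc2 : c ^ 2 = 8 * K / δ := Real.sq_sqrt (by positivity)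
  have h1 : 102 / Δ ^ 2 * Real.log (64 * c / Δ ^ 2) ≤ x :=
    (Nat.le_ceil _).trans (Nat.cast_le.2 ((le_max_right _ _).trans hx))
  have h2 : 102 / 64 * (64 / Δ ^ 2) * Real.log (c * (64 / Δ ^ 2)) ≤ x := by
    refine le_of_eq_of_le ?_ h1
    congr 1
    · ring
    · congr 1; ring
  have h3 := mul_log_lt hc0 (by positivity : 0 < 64 / Δ ^ 2) hxr h2
  have e : Real.log (8 * K * (x : ℝ) ^ 2 / δ) = 2 * Real.log (c * x) := by
    have : 8 * K * (x : ℝ) ^ 2 / δ = (c * x) ^ 2 := by rw [mul_pow, hc2]; ring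
    rw [this, Real.log_pow]; norm_num
  have h4 : radius K δ x < Δ / 4 := by
    rw [radius, Real.sqrt_lt' (by positivity), e, div_lt_iff₀ hxr]
    rw [div_mul_eq_mul_div, div_lt_iff₀ (by positivity)] at h3
    linarith
  linarith

/-- For large gaps the logarithm is negative, so positivity is not automatic. By `log y ≥ 1 - 1 / y`
the product with `102 / Δ²` is at least `-102 / (64 c)`, where `c ≥ 4`. -/
lemma alphaArm_ge {δ Δ : ℝ} (hK : 2 ≤ K) (hδ : 0 < δ) (hδ1 : δ < 1) (hΔ : 0 < Δ) :
    3 / 5 ≤ alphaArm K δ Δ := by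
  have hK' : (2 : ℝ) ≤ K := by exact_mod_cast hK
  set c := √(8 * K / δ) with hc
  have hc4 : 4 ≤ c := Real.le_sqrt_of_sq_le (by rw [le_div_iff₀ hδ]; nlinarith)
  have hc0 : 0 < c := by linarith
  have hΔ2 : 0 < Δ ^ 2 := by positivity
  have h1 := Real.one_sub_inv_le_log_of_pos (by positivity : 0 < 64 * c / Δ ^ 2)
  have h2 : 102 / Δ ^ 2 * (1 - (64 * c / Δ ^ 2)⁻¹) = 102 / Δ ^ 2 - 102 / (64 * c) := by
    field_simp
  have h3 : 102 / (64 * c) ≤ 2 / 5 := by rw [div_le_iff₀ (by positivity)]; linarith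
  have h4 : 0 < 102 / Δ ^ 2 := by positivity
  have h5 := mul_le_mul_of_nonneg_left h1 h4.le
  unfold alphaArm
  rw [← hc]
  linarith

/-- The maximum with zero covers large gaps: if the logarithm is not positive, the threshold is one
pull although `alphaArm - 1` may be negative. -/
lemma threshold_sub_one_le {δ Δ : ℝ} :
    ((threshold K δ Δ - 1 : ℕ) : ℝ) ≤ max 0 (alphaArm K δ Δ - 1) := by
  unfold threshold alphaArm
  set z := 102 / Δ ^ 2 * Real.log (64 * √(8 * K / δ) / Δ ^ 2)
  rcases le_or_gt z 0 with hz | hz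
  · rw [Nat.ceil_eq_zero.2 hz]; simp
  · have h1 : 1 ≤ ⌈z⌉₊ := Nat.one_le_ceil_iff.2 hz
    rw [max_eq_right h1, Nat.cast_sub h1]
    have := Nat.ceil_lt_add_one hz.le
    refine le_trans ?_ (le_max_right _ _)
    push_cast
    linarith

lemma one_le_log_params {δ : ℝ} (hK : 2 ≤ K) (hδ : 0 < δ) (hδ1 : δ < 1) :
    1 ≤ Real.log (2 * K / δ) := by
  have hK' : (2 : ℝ) ≤ K := by exact_mod_cast hK
  rw [Real.le_log_iff_exp_le (by positivity)]
  have h := Real.exp_one_lt_d9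
  have : 4 ≤ 2 * (K : ℝ) / δ := by rw [le_div_iff₀ hδ]; nlinarith
  linarith

lemma betaArm_pos {δ Δ q : ℝ} (hK : 2 ≤ K) (hδ : 0 < δ) (hδ1 : δ < 1) (hΔ : 0 < Δ) (hq : 0 < q) :
    0 < betaArm K δ Δ q := by
  have h1 := alphaArm_ge hK hδ hδ1 hΔ
  have h2 := one_le_log_params hK hδ hδ1
  unfold betaArm
  have := Real.sqrt_nonneg (Real.log (2 * K / δ) * (Real.log (2 * K / δ) + alphaArm K δ Δ))
  exact mul_pos (by positivity) (by linarith)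

/-- After `N ≥ β - 1` selections the Chernoff exponent for fewer than `threshold` pulls is at least
`log (2 K / δ)`. -/
lemma exists_chernoff_beta {δ Δ q N : ℝ} (hK : 2 ≤ K) (hδ : 0 < δ) (hδ1 : δ < 1) (hΔ : 0 < Δ)
    (hq : 0 < q) (hq1 : q ≤ 1) (hN : betaArm K δ Δ q - 1 ≤ N) :
    ∃ θ : ℝ, 0 ≤ θ ∧ Real.log (2 * K / δ) ≤
      N * q * (1 - Real.exp (-θ)) - θ * ((threshold K δ Δ - 1 : ℕ) : ℝ) := by
  have h1 := alphaArm_ge hK hδ hδ1 hΔ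
  have hL := one_le_log_params hK hδ hδ1
  have ha := threshold_sub_one_le (K := K) (δ := δ) (Δ := Δ)
  have ha0 : (0 : ℝ) ≤ ((threshold K δ Δ - 1 : ℕ) : ℝ) := Nat.cast_nonneg _
  unfold betaArm at hN
  set α := alphaArm K δ Δ
  set L := Real.log (2 * K / δ)
  set a := ((threshold K δ Δ - 1 : ℕ) : ℝ)
  refine exists_chernoff ha0 (by linarith) ?_
  -- Rounding `β` down to an integer costs at most one selection, hence at most `q ≤ 1` expected
  -- pulls.
  have hNq : α + 2 * L + 2 * √(L * (L + α)) - 1 ≤ N * q := by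
    have h2 := mul_le_mul_of_nonneg_right hN hq.le
    have h3 : (1 / q * (α + 2 * L + 2 * √(L * (L + α))) - 1) * q =
        α + 2 * L + 2 * √(L * (L + α)) - q := by field_simp
    linarith
  have hs0 : L ≤ √(L * (L + α)) := Real.le_sqrt_of_sq_le (by nlinarith)
  -- For `α ≥ 1` the lost unit is offset by `a ≤ α - 1`. Otherwise `a = 0`, the requirement is `2
  -- L`, and the square root term, at least `2 L ≥ 2`, offsets the loss.
  rcases le_total 1 α with hα | hα
  · rw [max_eq_right (by linarith)] at ha
    have h4 : √(L ^ 2 + 2 * a * L) ≤ 2 * √(L * (L + α)) := by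
      refine Real.sqrt_le_iff.2 ⟨by positivity, ?_⟩
      rw [mul_pow, Real.sq_sqrt (by nlinarith)]
      nlinarith
    linarith
  · rw [max_eq_left (by linarith)] at ha
    have ha' : a = 0 := le_antisymm ha ha0
    rw [ha']
    have h4 : √(L ^ 2 + 2 * 0 * L) = L := by
      rw [mul_zero, zero_mul, add_zero, Real.sqrt_sq (by linarith)]
    rw [h4]
    linarith

/-! ### Invariants of the algorithm -/

lemma pullCount_succ (k : Fin K) {t : ℕ} (h : History M K (t + 1)) :
    pullCount k h = pullCount k (Fin.init h : History M K t) +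
      if (h (Fin.last t)).2.1 = k then 1 else 0 := Fin.sum_univ_castSucc _

lemma rewardSum_succ (k : Fin K) {t : ℕ} (h : History M K (t + 1)) :
    rewardSum k h = rewardSum k (Fin.init h : History M K t) +
      if (h (Fin.last t)).2.1 = k then (h (Fin.last t)).2.2 else 0 := Fin.sum_univ_castSucc _

lemma selCount_succ (m : Fin M) {t : ℕ} (h : History M K (t + 1)) :
    selCount m h = selCount m (Fin.init h : History M K t) +
      if (h (Fin.last t)).1 = m then 1 else 0 := Fin.sum_univ_castSucc _

namespace Memory

/-- No round can be ended. -/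
def Settled (s : Memory K) : Prop := ¬ (1 < #s.active ∧ ∀ k ∈ s.active, s.round ≤ s.pulls k)

@[simp] lemma pulls_endRound (δ : ℝ) (s : Memory K) : (endRound δ s).pulls = s.pulls := by
  unfold endRound; split_ifs <;> rfl

@[simp] lemma total_endRound (δ : ℝ) (s : Memory K) : (endRound δ s).total = s.total := by
  unfold endRound; split_ifs <;> rfl

@[simp] lemma pulls_iterate (δ : ℝ) (s : Memory K) (n : ℕ) :
    ((endRound δ)^[n] s).pulls = s.pulls := by
  induction n with
  | zero => rfl
  | succ n ih => rw [Function.iterate_succ_apply', pulls_endRound, ih]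

@[simp] lemma total_iterate (δ : ℝ) (s : Memory K) (n : ℕ) :
    ((endRound δ)^[n] s).total = s.total := by
  induction n with
  | zero => rfl
  | succ n ih => rw [Function.iterate_succ_apply', total_endRound, ih]

/-- Each iteration either changes nothing or raises the round number. If it rose in all of the `∑ k,
s.pulls k` iterations, it now exceeds the number of pulls of every arm, and no further round can
end. -/
lemma settled_settle (δ : ℝ) (s : Memory K) (hs : 1 ≤ s.round) : (settle δ s).Settled := by
  have key : ∀ n : ℕ, ((endRound δ)^[n] s).Settled ∨ ((endRound δ)^[n] s).round = s.round + n := by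
    intro n
    induction n with
    | zero => exact .inr rfl
    | succ n ih =>
      rw [Function.iterate_succ_apply']
      by_cases h : ((endRound δ)^[n] s).Settled
      · left
        rwa [endRound, if_neg h]
      · right
        have h' := ih.resolve_left h
        rw [endRound, if_pos (not_not.1 h)]
        simp only [h']
        ring
  rcases key (∑ k, s.pulls k) with h | h
  · exact h
  · rintro ⟨h1, h2⟩
    obtain ⟨k, hk⟩ := Finset.card_pos.1 (zero_lt_one.trans h1)
    have h3 : (settle δ s).round ≤ (settle δ s).pulls k := h2 k hk
    have h4 : (settle δ s).round = s.round + ∑ k, s.pulls k := h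
    rw [h4, settle, pulls_iterate] at h3
    have h5 : s.pulls k ≤ ∑ k, s.pulls k :=
      Finset.single_le_sum (f := s.pulls) (fun _ _ => Nat.zero_le _) (Finset.mem_univ k)
    omega

lemma pulls_after (δ : ℝ) (k : Fin K) : ∀ t (h : History M K t), (after δ t h).pulls k = pullCount k h
  | 0, _ => by simp [after, init, pullCount]
  | t + 1, h => by
    have ih := pulls_after δ k t (Fin.init h)
    simp only [after, settle, pulls_iterate, record]
    rw [pullCount_succ, ← ih]
    by_cases hk : (h (Fin.last t)).2.1 = k
    · subst hk; simp
    · simp [Function.update_of_ne (Ne.symm hk), hk]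

lemma total_after (δ : ℝ) (k : Fin K) : ∀ t (h : History M K t), (after δ t h).total k = rewardSum k h
  | 0, _ => by simp [after, init, rewardSum]
  | t + 1, h => by
    have ih := total_after δ k t (Fin.init h)
    simp only [after, settle, total_iterate, record]
    rw [rewardSum_succ, ← ih]
    by_cases hk : (h (Fin.last t)).2.1 = k
    · subst hk; simp
    · simp [Function.update_of_ne (Ne.symm hk), hk]

/-- The best arm `b` is active, and every other active arm `k` has not yet survived round `n k`. -/
structure Inv (b : Fin K) (n : Fin K → ℕ) (s : Memory K) : Prop where
  best : b ∈ s.active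
  one_le : 1 ≤ s.round
  round_le : ∀ k ∈ s.active, k ≠ b → s.round ≤ n k

/-- All empirical means are within the confidence radius. -/
def Conf (δ : ℝ) (μ : Fin K → ℝ) (s : Memory K) : Prop :=
  ∀ k, 1 ≤ s.pulls k → |s.total k / s.pulls k - μ k| ≤ radius K δ (s.pulls k)

/-- The best arm survives because valid intervals contain the true means. For the elimination of
`k`, its upper bound is at most `μ k` plus two radii and the lower bound of `b` at least `μ b` minus
two radii. If each radius is below a quarter of the gap, these bounds are separated. -/
lemma Inv.endRound {b : Fin K} {n : Fin K → ℕ} {s : Memory K} (hs : Inv b n s) {δ : ℝ}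
    {μ : Fin K → ℝ} (hμ : ∀ k, k ≠ b → μ k < μ b) (hc : Conf δ μ s)
    (hn : ∀ k, k ≠ b → ∀ x, n k ≤ x → 4 * radius K δ x < μ b - μ k) :
    Inv b n (Memory.endRound δ s) := by
  unfold Memory.endRound
  split_ifs with h
  · have hle : ∀ k ∈ s.active, 1 ≤ s.pulls k := fun k hk => hs.one_le.trans (h.2 k hk)
    refine ⟨?_, Nat.le_add_left _ _, ?_⟩
    · refine Finset.mem_filter.2 ⟨hs.best, ?_⟩
      rintro ⟨j, hj, hlt⟩
      have h1 := abs_le.1 (hc b (hle b hs.best))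
      have h2 := abs_le.1 (hc j (hle j hj))
      unfold ucb lcb at hlt
      have h3 : μ j ≤ μ b := by
        by_cases hjb : j = b
        · rw [hjb]
        · exact (hμ j hjb).le
      linarith
    · intro k hk hkb
      obtain ⟨hka, hks⟩ := Finset.mem_filter.1 hk
      by_contra hcon
      have hnr : n k ≤ s.round := by simp only at hcon; omega
      refine hks ⟨b, hs.best, ?_⟩
      have h1 := abs_le.1 (hc b (hle b hs.best))
      have h2 := abs_le.1 (hc k (hle k hka))
      have h3 := hn k hkb _ (hnr.trans (h.2 k hka))
      have h4 := hn k hkb _ (hnr.trans (h.2 b hs.best))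
      unfold ucb lcb
      linarith
  · exact hs

lemma Inv.settle {b : Fin K} {n : Fin K → ℕ} {s : Memory K} (hs : Inv b n s) {δ : ℝ}
    {μ : Fin K → ℝ} (hμ : ∀ k, k ≠ b → μ k < μ b) (hc : Conf δ μ s)
    (hn : ∀ k, k ≠ b → ∀ x, n k ≤ x → 4 * radius K δ x < μ b - μ k) :
    Inv b n (Memory.settle δ s) := by
  have : ∀ i : ℕ, Inv b n ((Memory.endRound δ)^[i] s) := by
    intro i
    induction i with
    | zero => exact hs
    | succ i ih =>
      rw [Function.iterate_succ_apply']
      refine ih.endRound hμ ?_ hn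
      unfold Conf at hc ⊢
      rwa [pulls_iterate, total_iterate]
  exact this _

lemma exists_of_decide_eq_inl [NeZero K] {s : Memory K} {m : Fin M}
    (h : decide box s = Sum.inl m) :
    1 < #s.active ∧ ∃ k ∈ s.active, s.pulls k < s.round ∧ box k = m := by
  unfold decide at h
  split_ifs at h with h1
  have hm : m ∈ pending box s := by
    rw [← Sum.inl_injective h]
    exact Finset.min'_mem _ _
  obtain ⟨k, hk, rfl⟩ := Finset.mem_image.1 hm
  obtain ⟨hk1, hk2⟩ := Finset.mem_filter.1 hk
  exact ⟨h1.1, k, hk1, hk2, rfl⟩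

/-- If two arms were active, a settled memory would have an arm that lags behind the round, hence a
pending box to select. So stopping leaves at most one active arm, which is `b`. -/
lemma eq_best_of_decide_eq_inr [NeZero K] {s : Memory K} {a b : Fin K} (hs : s.Settled)
    (hb : b ∈ s.active) (h : decide box s = Sum.inr a) : a = b := by
  have hcard : #s.active ≤ 1 := by
    by_contra hc
    refine hs ⟨by omega, fun k hk => ?_⟩
    by_contra hlt
    have hp : (pending box s).Nonempty :=
      ⟨box k, Finset.mem_image_of_mem _ (Finset.mem_filter.2 ⟨hk, by omega⟩)⟩
    unfold decide at h
    rw [dif_pos ⟨by omega, hp⟩] at h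
    exact Sum.inl_ne_inr h
  unfold decide at h
  rw [dif_neg (fun hc => by omega), dif_pos ⟨b, hb⟩] at h
  rw [← Sum.inr_injective h]
  exact Finset.card_le_one.1 hcard _ (Finset.min'_mem _ _) _ hb

end Memory

/-! ### Trajectories of the algorithm -/

lemma sum_selCount {t : ℕ} (h : History M K t) : ∑ m, selCount m h = t := by
  unfold selCount
  rw [Finset.sum_comm]
  simp

/-- A trajectory on which all confidence intervals are valid and no box has to be selected more than
`N` times ends with the declaration of the best arm. -/
theorem declares_of_conf [NeZero K] {ω : Traj M K} {δ : ℝ} {μ : Fin K → ℝ} {b : Fin K}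
    {n : Fin K → ℕ} {N : Fin M → ℕ} (h0 : (ω 0).isLeft)
    (htr : ∀ t, Transition box t (ω t) (ω (t + 1)))
    (hinl : ∀ t h h', ω t = Sum.inl h → ω (t + 1) = Sum.inl h' →
      Memory.decide box (Memory.after δ t h) = Sum.inl (h' (Fin.last t)).1)
    (hinr : ∀ t h a, ω t = Sum.inl h → ω (t + 1) = Sum.inr a →
      Memory.decide box (Memory.after δ t h) = Sum.inr a)
    (hμ : ∀ k, k ≠ b → μ k < μ b)
    (hn : ∀ k, k ≠ b → ∀ x, min (n k) (n b) ≤ x → 4 * radius K δ x < μ b - μ k)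
    (hn1 : ∀ k, 1 ≤ n k)
    (hconf : ∀ t h, ω t = Sum.inl h → ∀ k, 1 ≤ pullCount k h →
      |rewardSum k h / pullCount k h - μ k| ≤ radius K δ (pullCount k h))
    (hpull : ∀ t h, ω t = Sum.inl h → ∀ k, selCount (box k) h = N (box k) → n k ≤ pullCount k h) :
    Declares ω b ∧ stopTime ω ≤ ((∑ m, N m : ℕ) : ℝ≥0∞) := by
  have hprev : ∀ t h, ω (t + 1) = Sum.inl h → ω t = Sum.inl (Fin.init h) := by
    intro t h hh
    have := htr t
    rw [hh] at this
    rcases hs : ω t with x | a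
    · rw [hs] at this
      rw [this.1]
    · rw [hs] at this
      exact this.elim
  have hinv : ∀ t h, ω t = Sum.inl h → Memory.Inv b (fun k => min (n k) (n b))
      (Memory.after δ t h) ∧ (Memory.after δ t h).Settled := by
    intro t
    induction t with
    | zero =>
      intro h _
      refine ⟨⟨Finset.mem_univ b, le_rfl, fun k _ _ => le_min (hn1 k) (hn1 b)⟩, ?_⟩
      rintro ⟨_, h2⟩
      exact absurd (h2 b (Finset.mem_univ b)) (by simp [Memory.after, Memory.init])
    | succ t ih =>
      intro h hh
      have hi := (ih _ (hprev t h hh)).1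
      set s := (Memory.after δ t (Fin.init h)).record (h (Fin.last t)).2.1 (h (Fin.last t)).2.2
      have hs : Memory.Inv b (fun k => min (n k) (n b)) s := ⟨hi.best, hi.one_le, hi.round_le⟩
      refine ⟨hs.settle hμ ?_ hn, Memory.settled_settle δ s hs.one_le⟩
      intro k hk
      have e1 : s.pulls k = pullCount k h := by
        rw [← Memory.pulls_after δ k (t + 1) h]
        exact (congrFun (Memory.pulls_iterate δ s _) k).symm
      have e2 : s.total k = rewardSum k h := by
        rw [← Memory.total_after δ k (t + 1) h]
        exact (congrFun (Memory.total_iterate δ s _) k).symm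
      rw [e1] at hk ⊢
      rw [e2]
      exact hconf (t + 1) h hh k hk
  have hsel : ∀ t h, ω t = Sum.inl h → ∀ m, selCount m h ≤ N m := by
    intro t
    induction t with
    | zero => intro h _ m; simp [selCount]
    | succ t ih =>
      intro h hh m
      have hp := hprev t h hh
      have h1 := ih _ hp m
      rw [selCount_succ]
      split_ifs with hm
      · rcases h1.lt_or_eq with hlt | heq
        · exact hlt
        · exfalso
          obtain ⟨hi, -⟩ := hinv t _ hp
          obtain ⟨hcard, k, hk, hlt, hbox⟩ :=
            Memory.exists_of_decide_eq_inl (hinl t _ h hp hh)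
          rw [hm] at hbox
          subst hbox
          have h2 := hpull t _ hp k heq
          rw [Memory.pulls_after] at hlt
          -- The best arm has no elimination round of its own, but while boxes are selected some
          -- other arm `j` is active. Its bound `min (n j) (n b)` gives the round bound `n b`,
          -- without any monotonicity of `n` in the gap.
          have h3 : (Memory.after δ t (Fin.init h)).round ≤ n k := by
            by_cases hkb : k = b
            · obtain ⟨j, hj, hjb⟩ := Finset.exists_mem_ne hcard b
              rw [hkb]
              exact (hi.round_le j hj hjb).trans (min_le_right _ _)
            · exact (hi.round_le k hk hkb).trans (min_le_left _ _)
          omega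
      · exact h1
  have hlen : ∀ t h, ω t = Sum.inl h → t ≤ ∑ m, N m := fun t h hh => by
    calc t = ∑ m, selCount m h := (sum_selCount h).symm
      _ ≤ _ := Finset.sum_le_sum fun m _ => hsel t h hh m
  have hex : ∃ t, (ω t).isRight := by
    -- A history of length `∑ m, N m` may still be running; only the next state must be a stopped
    -- one.
    refine ⟨∑ m, N m + 1, ?_⟩
    rcases hs : ω (∑ m, N m + 1) with h | a
    · have := hlen _ h hs
      omega
    · rfl
  classical
  obtain ⟨t, ht⟩ : ∃ t, Nat.find hex = t + 1 := by
    refine Nat.exists_eq_succ_of_ne_zero fun hz => ?_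
    have := Nat.find_spec hex
    rw [hz] at this
    cases hs : ω 0 <;> simp [hs] at h0 this
  have hr : (ω (t + 1)).isRight := ht ▸ Nat.find_spec hex
  have hl : ¬ (ω t).isRight := Nat.find_min hex (by omega)
  obtain ⟨a, ha⟩ := Sum.isRight_iff.1 hr
  obtain ⟨h, hh⟩ := Sum.isLeft_iff.1 (Sum.not_isRight.1 hl)
  obtain ⟨hi, hst⟩ := hinv t h hh
  have hab := Memory.eq_best_of_decide_eq_inr hst hi.best (hinr t h a hh ha)
  refine ⟨⟨t + 1, by rw [ha, hab]⟩, ?_⟩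
  refine (iInf₂_le t hr).trans ?_
  exact_mod_cast hlen t h hh

/-! ### Correctness and stopping time of the algorithm -/

/-- The transitions that follow the decisions of the algorithm. -/
def FollowsDecision (box : Fin K → Fin M) [NeZero K] (δ : ℝ) (t : ℕ) :
    State M K t → State M K (t + 1) → Prop
  | .inl h, .inl h' => Memory.decide box (Memory.after δ t h) = Sum.inl (h' (Fin.last t)).1
  | .inl h, .inr a => Memory.decide box (Memory.after δ t h) = Sum.inr a
  | .inr _, _ => True

lemma measurableSet_followsDecision [NeZero K] (δ : ℝ) (t : ℕ) :
    MeasurableSet {x : State M K t × State M K (t + 1) | FollowsDecision box δ t x.1 x.2} := by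
  have hd : Measurable fun h : History M K t => Memory.decide box (Memory.after δ t h) :=
    (Memory.isMeas_after δ t).decide box
  refine measurableSet_sum_prod ?_ ?_ ?_ ?_
  · have hl : Measurable fun x : History M K t × History M K (t + 1) => x.2 (Fin.last t) :=
      (measurable_pi_apply _).comp measurable_snd
    exact measurableSet_eq_fun (hd.comp measurable_fst) (measurable_inl.comp hl.fst)
  · exact measurableSet_eq_fun (hd.comp measurable_fst) (measurable_inr.comp measurable_snd)
  · exact MeasurableSet.univ
  · exact MeasurableSet.univ

lemma ae_followsDecision [NeZero K] (C : Problem box) (δ : ℝ) :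
    ∀ᵐ ω ∂((bbsea box δ).law C), ∀ t, FollowsDecision box δ t (ω t) (ω (t + 1)) := by
  refine ae_all_iff.2 fun t => ae_step _ C t (measurableSet_followsDecision δ t) fun s => ?_
  have hm : Measurable ({y | ¬ FollowsDecision box δ t s y}.indicator
      (1 : State M K (t + 1) → ℝ≥0∞)) :=
    measurable_one.indicator (measurable_prodMk_left (measurableSet_followsDecision δ t).compl)
  rcases s with h | a
  · rw [lintegral_step_inl _ C t h hm]
    change ∫⁻ a, _ ∂(Kernel.deterministic _ ((Memory.isMeas_after δ t).decide box) h) = 0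
    rw [Kernel.lintegral_deterministic]
    rcases hd : Memory.decide box (Memory.after δ t h) with m | a
    · refine lintegral_eq_zero_of_ae_eq_zero (.of_forall fun z => ?_)
      refine Set.indicator_of_notMem ?_ _
      simp [FollowsDecision, hd]
    · simp [FollowsDecision, hd]
  · rw [lintegral_step_inr _ C t a hm]
    simp [FollowsDecision]

lemma Problem.gap_pos {C : Problem box} {b : Fin K} (hK : 2 ≤ K) (hb : C.IsBest b) (k : Fin K) :
    0 < C.gap b k := by
  unfold Problem.gap
  split_ifs with h
  · have : Nontrivial (Fin K) := Fin.nontrivial_iff_two_le.2 hK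
    obtain ⟨j, hj⟩ := exists_ne b
    have : Nonempty {j : Fin K // j ≠ b} := ⟨⟨j, hj⟩⟩
    obtain ⟨i, hi⟩ := exists_eq_ciInf_of_finite (f := fun j : {j : Fin K // j ≠ b} =>
      C.mean b - C.mean j)
    rw [← hi]
    exact sub_pos.2 (hb i i.2)
  · exact sub_pos.2 (hb k h)

lemma Problem.gap_best_le {C : Problem box} {b k : Fin K} (hk : k ≠ b) :
    C.gap b b ≤ C.mean b - C.mean k := by
  rw [Problem.gap, if_pos rfl]
  exact ciInf_le (f := fun j : {j : Fin K // j ≠ b} => C.mean b - C.mean j)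
    (Set.finite_range _).bddBelow ⟨k, hk⟩

lemma Problem.q_le_one (C : Problem box) (k : Fin K) : C.q k ≤ 1 := by
  rw [← C.q_sum (box k)]
  exact Finset.single_le_sum (fun j _ => (C.q_pos j).le) (by simp)

lemma Problem.exists_box_eq (C : Problem box) (m : Fin M) : ∃ k, box k = m := by
  by_contra h
  push Not at h
  have := C.q_sum m
  rw [Finset.filter_false_of_mem (fun k _ => h k)] at this
  simp at this

lemma Problem.betaArm_le_beta (C : Problem box) (b k : Fin K) (δ : ℝ) :
    betaArm K δ (C.gap b k) (C.q k) ≤ C.beta b δ (box k) :=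
  le_ciSup (f := fun j : {j : Fin K // box j = box k} => betaArm K δ (C.gap b j) (C.q j))
    (Set.finite_range _).bddAbove ⟨k, rfl⟩

/-- Some confidence interval is violated with probability at most `π² δ / 24`. -/
lemma law_deviation_le (π : Policy M K) (C : Problem box) {δ : ℝ} (hK : 2 ≤ K) (hδ : 0 < δ)
    (hδ1 : δ < 1) :
    π.law C {ω | ∃ t h, ω t = Sum.inl h ∧ ∃ k, 1 ≤ pullCount k h ∧
      radius K δ (pullCount k h) < |rewardSum k h / pullCount k h - C.mean k|} ≤
      ENNReal.ofReal (Real.pi ^ 2 / 24 * δ) := by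
  have hK' : (0 : ℝ) < K := by exact_mod_cast (by omega : 0 < K)
  let S : Fin K → ℕ → ℝ → Set (Traj M K) := fun k x l =>
    {ω | ∃ t, ∃ h ∈ {h : History M K t | pullCount k h = x ∧
      x * l ^ 2 ≤ l * (rewardSum k h - x * C.mean k)}, ω t = Sum.inl h}
  have hS : ∀ k x, π.law C (S k (x + 1) (radius K δ (x + 1)) ∪
      S k (x + 1) (-radius K δ (x + 1))) ≤
      ENNReal.ofReal (δ / (4 * K) * (1 / ((x + 1 : ℕ) : ℝ) ^ 2)) := by
    intro k x
    have hx : (0 : ℝ) < ((x + 1 : ℕ) : ℝ) := by positivity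
    have hlog := log_pos_of_params hK hδ hδ1 (Nat.le_add_left 1 x)
    -- The choice `l = ± radius` is the optimal tilt. Each side then has probability `δ / (8 K x²)`,
    -- which is summable over the numbers `x` of pulls.
    have hr : ((x + 1 : ℕ) : ℝ) * radius K δ (x + 1) ^ 2 / 2 =
        Real.log (8 * K * ((x + 1 : ℕ) : ℝ) ^ 2 / δ) := by
      rw [radius, Real.sq_sqrt (by positivity)]
      field_simp
    have he : Real.exp (-(((x + 1 : ℕ) : ℝ) * radius K δ (x + 1) ^ 2 / 2)) =
        δ / (8 * K) * (1 / ((x + 1 : ℕ) : ℝ) ^ 2) := by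
      rw [hr, Real.exp_neg, Real.exp_log (by positivity)]
      field_simp
    have h1 : π.law C (S k (x + 1) (radius K δ (x + 1))) ≤ _ :=
      law_rewardSum_le π C k (x + 1) (radius K δ (x + 1))
    have h2 : π.law C (S k (x + 1) (-radius K δ (x + 1))) ≤ _ :=
      law_rewardSum_le π C k (x + 1) (-radius K δ (x + 1))
    rw [he] at h1
    rw [neg_sq, he] at h2
    refine (measure_union_le _ _).trans ((add_le_add h1 h2).trans ?_)
    rw [← ENNReal.ofReal_add (by positivity) (by positivity)]
    refine ENNReal.ofReal_le_ofReal (le_of_eq ?_)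
    field_simp
    norm_num
  have hsum : ∑' x : ℕ, ENNReal.ofReal (δ / (4 * K) * (1 / ((x + 1 : ℕ) : ℝ) ^ 2)) =
      ENNReal.ofReal (δ / (4 * K) * (Real.pi ^ 2 / 6)) := by
    have h1 : HasSum (fun x : ℕ => 1 / ((x + 1 : ℕ) : ℝ) ^ 2) (Real.pi ^ 2 / 6) := by
      simpa using (hasSum_nat_add_iff' 1).2 hasSum_zeta_two
    have h2 := h1.mul_left (δ / (4 * K))
    rw [← ENNReal.ofReal_tsum_of_nonneg (fun x => by positivity) h2.summable, h2.tsum_eq]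
  calc _ ≤ π.law C (⋃ k, ⋃ x : ℕ, (S k (x + 1) (radius K δ (x + 1)) ∪
        S k (x + 1) (-radius K δ (x + 1)))) := by
        refine measure_mono ?_
        rintro ω ⟨t, h, hh, k, hk, hlt⟩
        obtain ⟨x, hx⟩ := Nat.exists_eq_add_of_le' hk
        refine Set.mem_iUnion.2 ⟨k, Set.mem_iUnion.2 ⟨x, ?_⟩⟩
        rw [hx] at hlt
        have hx0 : (0 : ℝ) < ((x + 1 : ℕ) : ℝ) := by positivity
        have hr := radius_pos hK hδ hδ1 (Nat.le_add_left 1 x)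
        have e : rewardSum k h / ((x + 1 : ℕ) : ℝ) - C.mean k =
            (rewardSum k h - ((x + 1 : ℕ) : ℝ) * C.mean k) / ((x + 1 : ℕ) : ℝ) := by
          field_simp
        rw [e] at hlt
        rcases lt_abs.1 hlt with h1 | h1
        · left
          rw [lt_div_iff₀ hx0] at h1
          refine ⟨t, h, ⟨hx, ?_⟩, hh⟩
          nlinarith
        · right
          rw [← neg_div, lt_div_iff₀ hx0] at h1
          refine ⟨t, h, ⟨hx, ?_⟩, hh⟩
          nlinarith
    _ ≤ ∑ k : Fin K, ∑' x : ℕ, ENNReal.ofReal (δ / (4 * K) * (1 / ((x + 1 : ℕ) : ℝ) ^ 2)) := by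
        refine (measure_iUnion_fintype_le _ _).trans (Finset.sum_le_sum fun k _ => ?_)
        exact (measure_iUnion_le _).trans (ENNReal.tsum_le_tsum (hS k))
    _ = _ := by
        rw [hsum, Finset.sum_const, Finset.card_univ, Fintype.card_fin, nsmul_eq_mul,
          ← ENNReal.ofReal_natCast, ← ENNReal.ofReal_mul hK'.le]
        congr 1
        field_simp
        norm_num

/-- After `⌊β_m⌋` selections of their box, some arm lacks pulls with probability at most `δ / 2`. -/
lemma law_pull_deficit_le (π : Policy M K) (C : Problem box) {b : Fin K} {δ : ℝ} (hK : 2 ≤ K)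
    (hb : C.IsBest b) (hδ : 0 < δ) (hδ1 : δ < 1) :
    π.law C {ω | ∃ t h, ω t = Sum.inl h ∧ ∃ k, selCount (box k) h = ⌊C.beta b δ (box k)⌋₊ ∧
      pullCount k h < threshold K δ (C.gap b k)} ≤ ENNReal.ofReal (δ / 2) := by
  have hK' : (0 : ℝ) < K := by exact_mod_cast (by omega : 0 < K)
  let S : Fin K → Set (Traj M K) := fun k =>
    {ω | ∃ t, ∃ h ∈ {h : History M K t | selCount (box k) h = ⌊C.beta b δ (box k)⌋₊ ∧
      pullCount k h ≤ threshold K δ (C.gap b k) - 1}, ω t = Sum.inl h}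
  have hS : ∀ k, π.law C (S k) ≤ ENNReal.ofReal (δ / (2 * K)) := by
    intro k
    have hN : betaArm K δ (C.gap b k) (C.q k) - 1 ≤ (⌊C.beta b δ (box k)⌋₊ : ℝ) := by
      have h1 := C.betaArm_le_beta b k δ
      have h2 := Nat.lt_floor_add_one (C.beta b δ (box k))
      linarith
    obtain ⟨θ, hθ, hle⟩ := exists_chernoff_beta hK hδ hδ1 (Problem.gap_pos hK hb k) (C.q_pos k)
      (C.q_le_one k) hN
    refine (law_pullCount_le π C k _ _ hθ).trans (ENNReal.ofReal_le_ofReal ?_)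
    calc _ ≤ Real.exp (-Real.log (2 * K / δ)) := Real.exp_le_exp.2 (neg_le_neg hle)
      _ = _ := by rw [Real.exp_neg, Real.exp_log (by positivity), inv_div]
  calc _ ≤ π.law C (⋃ k, S k) := by
        refine measure_mono ?_
        rintro ω ⟨t, h, hh, k, hk, hlt⟩
        exact Set.mem_iUnion.2 ⟨k, t, h, ⟨hk, by omega⟩, hh⟩
    _ ≤ ∑ k : Fin K, ENNReal.ofReal (δ / (2 * K)) :=
        (measure_iUnion_fintype_le _ _).trans (Finset.sum_le_sum fun k _ => hS k)
    _ = _ := by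
        rw [Finset.sum_const, Finset.card_univ, Fintype.card_fin, nsmul_eq_mul,
          ← ENNReal.ofReal_natCast, ← ENNReal.ofReal_mul hK'.le]
        congr 1
        field_simp

theorem bbsea_correct [NeZero K] (C : Problem box) (b : Fin K) (δ : ℝ) (hK : 2 ≤ K)
    (hb : C.IsBest b) (hδ : 0 < δ) (hδ1 : δ < 1) :
    ENNReal.ofReal (1 - δ) < (bbsea box δ).law C
      {ω | Declares ω b ∧ stopTime ω ≤ ENNReal.ofReal (∑ m, C.beta b δ m)} := by
  set P := (bbsea box δ).law C
  set T := {ω : Traj M K | Declares ω b ∧ stopTime ω ≤ ENNReal.ofReal (∑ m, C.beta b δ m)}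
  set B1 := {ω : Traj M K | ∃ t h, ω t = Sum.inl h ∧ ∃ k, 1 ≤ pullCount k h ∧
      radius K δ (pullCount k h) < |rewardSum k h / pullCount k h - C.mean k|}
  set B2 := {ω : Traj M K | ∃ t h, ω t = Sum.inl h ∧ ∃ k,
      selCount (box k) h = ⌊C.beta b δ (box k)⌋₊ ∧ pullCount k h < threshold K δ (C.gap b k)}
  have h1 : P B1 ≤ _ := law_deviation_le _ C hK hδ hδ1
  have h2 : P B2 ≤ _ := law_pull_deficit_le _ C hK hb hδ hδ1
  have hβ : ∀ m, 0 ≤ C.beta b δ m := fun m => by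
    obtain ⟨k, rfl⟩ := C.exists_box_eq m
    exact (betaArm_pos hK hδ hδ1 (Problem.gap_pos hK hb k) (C.q_pos k)).le.trans
      (C.betaArm_le_beta b k δ)
  have hcover : ∀ᵐ ω ∂P, ω ∈ (B1 ∪ B2) ∪ T := by
    filter_upwards [ae_zero _ C, ae_transition _ C, ae_followsDecision C δ] with ω h0 htr hfd
    by_cases hbad : ω ∈ B1 ∪ B2
    · exact .inl hbad
    · right
      have hB1 : ω ∉ B1 := fun h => hbad (.inl h)
      have hB2 : ω ∉ B2 := fun h => hbad (.inr h)
      obtain ⟨hd, hs⟩ := declares_of_conf (δ := δ) (μ := C.mean) (b := b)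
        (n := fun k => threshold K δ (C.gap b k)) (N := fun m => ⌊C.beta b δ m⌋₊) h0 htr
        (fun t h h' hh hh' => by simpa [hh, hh', FollowsDecision] using hfd t)
        (fun t h a hh hh' => by simpa [hh, hh', FollowsDecision] using hfd t)
        hb
        (fun k hk x hx => by
          rcases min_le_iff.1 hx with h | h
          · have := four_mul_radius_lt hK hδ (Problem.gap_pos hK hb k) h
            rwa [Problem.gap, if_neg hk] at this
          · exact (four_mul_radius_lt hK hδ (Problem.gap_pos hK hb b) h).trans_le
              (Problem.gap_best_le hk))
        (fun k => le_max_left _ _)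
        (fun t h hh k hk => by
          by_contra hc
          exact hB1 ⟨t, h, hh, k, hk, not_le.1 hc⟩)
        (fun t h hh k hk => by
          by_contra hc
          exact hB2 ⟨t, h, hh, k, hk, not_le.1 hc⟩)
      refine ⟨hd, hs.trans ?_⟩
      rw [← ENNReal.ofReal_natCast]
      refine ENNReal.ofReal_le_ofReal ?_
      push_cast
      exact Finset.sum_le_sum fun m _ => Nat.floor_le (hβ m)
  -- Subadditivity is used instead of a complement, so no measurability of `T` is needed.
  have hone : 1 ≤ P (B1 ∪ B2) + P T := by
    have : P ((B1 ∪ B2) ∪ T) = 1 :=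
      (measure_congr (Filter.eventuallyEq_univ.2 hcover)).trans measure_univ
    rw [← this]
    exact measure_union_le _ _
  by_contra hc
  have h3 : (1 : ℝ≥0∞) ≤ ENNReal.ofReal (Real.pi ^ 2 / 24 * δ + δ / 2 + (1 - δ)) := by
    rw [ENNReal.ofReal_add (by positivity) (by linarith),
      ENNReal.ofReal_add (by positivity) (by positivity)]
    exact hone.trans (add_le_add ((measure_union_le _ _).trans (add_le_add h1 h2)) (not_lt.1 hc))
  rw [← ENNReal.ofReal_one, ENNReal.ofReal_le_ofReal_iff
    (add_nonneg (by positivity) (by linarith))] at h3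
  have hπ : Real.pi ^ 2 < 12 := by nlinarith [Real.pi_lt_d2, Real.pi_pos]
  nlinarith [mul_lt_mul_of_pos_right hπ hδ]

/-! ### Order of the bound -/

/-- `β_{m,k}` is of the order of `log (K / (δ Δ)) / (q Δ²)`. -/
lemma betaArm_le {D r : ℝ} (hr : 1 < r) (hD : 1 ≤ D) : ∃ c : ℝ, 0 < c ∧
    ∀ {K : ℕ} {δ Δ q : ℝ}, 2 ≤ K → 0 < δ → δ < 1 → 0 < Δ → 0 < q → Δ ≤ D → r ≤ K / (δ * Δ) →
      betaArm K δ Δ q ≤ c * (Real.log (K / (δ * Δ)) / (q * Δ ^ 2)) := by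
  have hlr : 0 < Real.log r := Real.log_pos hr
  have hlD : 0 ≤ Real.log D := Real.log_nonneg hD
  -- Since `1 ≤ R * ℓ` and `1 ≤ D ^ 2 / Δ ^ 2`, additive constants can be absorbed into multiples of
  -- `ℓ / Δ²`.
  set R := 1 / Real.log r with hR
  have hR0 : 0 < R := by positivity
  set a := 1 + (Real.log 2 + Real.log D) * R with ha
  set e := 102 * ((Real.log 64 + Real.log 8) * R + 3 + Real.log D * R) with he
  have hl2 : 0 < Real.log 2 := Real.log_pos (by norm_num)
  have hl64 : 0 < Real.log 64 := Real.log_pos (by norm_num)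
  have hl8 : 0 < Real.log 8 := Real.log_pos (by norm_num)
  have ha0 : 0 < a := by positivity
  have he0 : 0 < e := by positivity
  refine ⟨2 * (R * D ^ 2 + e) + 4 * (a * D ^ 2), by positivity, ?_⟩
  intro K δ Δ q hK hδ hδ1 hΔ hq hΔD hrX
  have hK' : (2 : ℝ) ≤ K := by exact_mod_cast hK
  set X := K / (δ * Δ) with hX
  have hX0 : 0 < X := by positivity
  set ℓ := Real.log X with hℓ
  have hℓr : Real.log r ≤ ℓ := Real.log_le_log (by linarith) hrX
  have hℓ0 : 0 < ℓ := hlr.trans_le hℓr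
  have hone : 1 ≤ R * ℓ := by rw [hR, one_div_mul_eq_div, one_le_div hlr]; exact hℓr
  have hΔ2 : 0 < Δ ^ 2 := by positivity
  have hDΔ : 1 ≤ D ^ 2 / Δ ^ 2 := by
    rw [one_le_div hΔ2]; gcongr
  have hlogΔ : Real.log Δ ≤ Real.log D := Real.log_le_log hΔ hΔD
  have hKδ : Real.log (K / δ) = ℓ + Real.log Δ := by
    rw [hℓ, hX, ← Real.log_mul (by positivity) hΔ.ne']; congr 1; field_simp
  have hKδ0 : 0 ≤ Real.log (K / δ) :=
    Real.log_nonneg (by rw [le_div_iff₀ hδ]; nlinarith)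
  have hL : Real.log (2 * K / δ) = Real.log 2 + (ℓ + Real.log Δ) := by
    rw [← hKδ, ← Real.log_mul (by norm_num) (by positivity)]; congr 1; ring
  have hL1 := one_le_log_params hK hδ hδ1
  have hLa : Real.log (2 * K / δ) ≤ a * ℓ := by
    rw [hL, ha]
    nlinarith [mul_le_mul_of_nonneg_left hone (by positivity : 0 ≤ Real.log 2 + Real.log D)]
  have hin : Real.log (64 * √(8 * K / δ) / Δ ^ 2) =
      Real.log 64 + (Real.log 8 + Real.log (K / δ)) / 2 - 2 * Real.log Δ := by
    rw [Real.log_div (by positivity) (by positivity), Real.log_mul (by norm_num) (by positivity),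
      Real.log_sqrt (by positivity), Real.log_pow, mul_div_assoc,
      Real.log_mul (by norm_num) (by positivity)]
    norm_num
  have hin2 : Real.log (64 * √(8 * K / δ) / Δ ^ 2) ≤ e / 102 * ℓ := by
    -- For small gaps `-log Δ` is large, but `K / δ ≥ 1` gives `-log Δ ≤ ℓ`.
    rw [hin, he]
    have h1 := mul_le_mul_of_nonneg_left hone
      (by positivity : 0 ≤ Real.log 64 + Real.log 8 + Real.log D)
    nlinarith
  have hα := alphaArm_ge hK hδ hδ1 hΔ
  have hα2 : alphaArm K δ Δ ≤ (R * D ^ 2 + e) * (ℓ / Δ ^ 2) := by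
    unfold alphaArm
    have h1 : 102 / Δ ^ 2 * Real.log (64 * √(8 * K / δ) / Δ ^ 2) ≤ 102 / Δ ^ 2 * (e / 102 * ℓ) :=
      mul_le_mul_of_nonneg_left hin2 (by positivity)
    have h2 : 1 ≤ (R * ℓ) * (D ^ 2 / Δ ^ 2) := one_le_mul_of_one_le_of_one_le hone hDΔ
    calc _ ≤ (R * ℓ) * (D ^ 2 / Δ ^ 2) + 102 / Δ ^ 2 * (e / 102 * ℓ) := add_le_add h2 h1
      _ = _ := by field_simp
  have hL2 : Real.log (2 * K / δ) ≤ a * D ^ 2 * (ℓ / Δ ^ 2) := by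
    calc _ ≤ a * ℓ * 1 := by rw [mul_one]; exact hLa
      _ ≤ a * ℓ * (D ^ 2 / Δ ^ 2) := by gcongr
      _ = _ := by ring
  -- The inequality of arithmetic and geometric means for the two factors.
  have hsqrt : 2 * √(Real.log (2 * K / δ) * (Real.log (2 * K / δ) + alphaArm K δ Δ)) ≤
      2 * Real.log (2 * K / δ) + alphaArm K δ Δ := by
    rw [← le_div_iff₀' (by norm_num)]
    refine Real.sqrt_le_iff.2 ⟨by positivity, ?_⟩
    nlinarith [sq_nonneg (alphaArm K δ Δ)]
  unfold betaArm
  calc _ ≤ 1 / q * (2 * ((R * D ^ 2 + e) * (ℓ / Δ ^ 2)) + 4 * (a * D ^ 2 * (ℓ / Δ ^ 2))) := by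
        refine mul_le_mul_of_nonneg_left ?_ (by positivity)
        linarith
    _ = _ := by field_simp

theorem beta_le (D r : ℝ) (hr : 1 < r) : ∃ c : ℝ, 0 < c ∧
    ∀ {M K : ℕ} (box : Fin K → Fin M) (C : Problem box) (b : Fin K) (δ : ℝ),
      2 ≤ K → C.IsBest b → 0 < δ → δ < 1 →
      ∀ m, (∀ k, box k = m → C.gap b k ≤ D ∧ r ≤ K / (δ * C.gap b k)) →
        C.beta b δ m ≤ c * ⨆ k : {k : Fin K // box k = m},
          Real.log (K / (δ * C.gap b k)) / (C.q k * C.gap b k ^ 2) := by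
  obtain ⟨c, hc, h⟩ := betaArm_le hr (le_max_right D 1)
  refine ⟨c, hc, ?_⟩
  intro M K box C b δ hK hb hδ hδ1 m hm
  obtain ⟨k0, hk0⟩ := C.exists_box_eq m
  have : Nonempty {k : Fin K // box k = m} := ⟨⟨k0, hk0⟩⟩
  refine ciSup_le fun k => ?_
  refine (h hK hδ hδ1 (Problem.gap_pos hK hb k) (C.q_pos k)
    ((hm k k.2).1.trans (le_max_left _ _)) (hm k k.2).2).trans ?_
  gcongr
  exact le_ciSup (f := fun k : {k : Fin K // box k = m} =>
    Real.log (K / (δ * C.gap b k)) / (C.q k * C.gap b k ^ 2)) (Set.finite_range _).bddAbove k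

/-! ### Gaussian rewards with shifted means -/

lemma lintegral_gaussianReal_add (μ d : ℝ) {f : ℝ → ℝ≥0∞} (hf : Measurable f) :
    ∫⁻ x, f x ∂(gaussianReal (μ + d) 1) =
      ∫⁻ x, f x * ENNReal.ofReal (Real.exp (d * (x - μ) - d ^ 2 / 2)) ∂(gaussianReal μ 1) := by
  rw [gaussianReal_of_var_ne_zero _ one_ne_zero, gaussianReal_of_var_ne_zero _ one_ne_zero,
    lintegral_withDensity_eq_lintegral_mul _ (measurable_gaussianPDF _ _) hf,
    lintegral_withDensity_eq_lintegral_mul _ (measurable_gaussianPDF _ _) (by fun_prop)]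
  refine lintegral_congr fun x => ?_
  have h : gaussianPDF (μ + d) 1 x =
      gaussianPDF μ 1 x * ENNReal.ofReal (Real.exp (d * (x - μ) - d ^ 2 / 2)) := by
    rw [gaussianPDF, gaussianPDF, ← ENNReal.ofReal_mul (gaussianPDFReal_nonneg _ _ _)]
    congr 1
    simp only [gaussianPDFReal, NNReal.coe_one]
    rw [mul_assoc (√(2 * Real.pi * 1))⁻¹, ← Real.exp_add]
    congr 2
    ring
  simp only [Pi.mul_apply]
  rw [h]
  ring

lemma integrable_logDensity (μ d : ℝ) :
    Integrable (fun x => d * (x - μ) - d ^ 2 / 2) (gaussianReal μ 1) := by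
  have h : Integrable (fun x : ℝ => x) (gaussianReal μ 1) :=
    memLp_one_iff_integrable.1 (memLp_id_gaussianReal 1)
  exact ((h.sub (integrable_const μ)).const_mul d).sub (integrable_const _)

lemma lintegral_logDensity_ne_top (μ d : ℝ) :
    ∫⁻ x, ENNReal.ofReal (d * (x - μ) - d ^ 2 / 2) ∂(gaussianReal μ 1) ≠ ∞ :=
  ((lintegral_mono fun _ => Real.ofReal_le_enorm _).trans_lt
    (integrable_logDensity μ d).hasFiniteIntegral).ne

/-- The Gaussian relative entropy `d² / 2`, written with positive and negative parts. In this form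
it passes through the law of the process before integrability is known. -/
lemma lintegral_neg_logDensity (μ d : ℝ) :
    ∫⁻ x, ENNReal.ofReal (-(d * (x - μ) - d ^ 2 / 2)) ∂(gaussianReal μ 1) =
      ∫⁻ x, ENNReal.ofReal (d * (x - μ) - d ^ 2 / 2) ∂(gaussianReal μ 1) +
        ENNReal.ofReal (d ^ 2 / 2) := by
  have hi := integrable_logDensity μ d
  have h := integral_eq_lintegral_pos_part_sub_lintegral_neg_part hi
  have hint : Integrable (fun x : ℝ => x) (gaussianReal μ 1) :=
    memLp_one_iff_integrable.1 (memLp_id_gaussianReal 1)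
  have h2 : ∫ x, (d * (x - μ) - d ^ 2 / 2) ∂(gaussianReal μ 1) = -(d ^ 2 / 2) := by
    have hsub : Integrable (fun x => d * (x - μ)) (gaussianReal μ 1) :=
      (hint.sub (integrable_const μ)).const_mul d
    rw [integral_sub hsub (integrable_const _),
      integral_const_mul, integral_sub hint (integrable_const μ), integral_id_gaussianReal]
    simp
  rw [h2] at h
  have f1 := lintegral_logDensity_ne_top μ d
  have f2 : ∫⁻ x, ENNReal.ofReal (-(d * (x - μ) - d ^ 2 / 2)) ∂(gaussianReal μ 1) ≠ ∞ :=
    ((lintegral_mono fun _ => Real.ofReal_le_enorm _).trans_lt hi.neg.hasFiniteIntegral).ne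
  rw [← ENNReal.toReal_eq_toReal_iff' f2 (ENNReal.add_ne_top.2 ⟨f1, ENNReal.ofReal_ne_top⟩),
    ENNReal.toReal_add f1 ENNReal.ofReal_ne_top, ENNReal.toReal_ofReal (by positivity)]
  linarith

/-- The instance with Gaussian rewards whose mean rewards are shifted by `d`. -/
def Problem.shift (C : Problem box) (d : Fin K → ℝ) : Problem box where
  q := C.q
  ν k := gaussianReal (C.mean k + d k) 1
  q_pos := C.q_pos
  q_sum := C.q_sum
  prob _ := inferInstance
  subGaussian k := by
    simp only [integral_id_gaussianReal]
    constructor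
    · intro t
      have e : ∀ x, Real.exp (t * (x - (C.mean k + d k))) =
          Real.exp (t * x) * Real.exp (-(t * (C.mean k + d k))) := fun x => by
        rw [← Real.exp_add]; congr 1; ring
      simp_rw [e]
      exact (integrable_exp_mul_gaussianReal t).mul_const _
    · intro t
      rw [mgf_gaussianReal (μ := 0) (v := 1)]
      · simp
      · rw [gaussianReal_map_sub_const]; simp

lemma Problem.mean_shift (C : Problem box) (d : Fin K → ℝ) (k : Fin K) :
    (C.shift d).mean k = C.mean k + d k := integral_id_gaussianReal

/-- The logarithmic likelihood ratio of one observation. -/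
def Problem.logRatio (C : Problem box) (d : Fin K → ℝ) (o : Obs M K) : ℝ :=
  d o.2.1 * (o.2.2 - C.mean o.2.1) - d o.2.1 ^ 2 / 2

lemma Problem.measurable_logRatio (C : Problem box) (d : Fin K → ℝ) :
    Measurable (C.logRatio (M := M) d) := by
  have h1 : Measurable fun o : Obs M K => d o.2.1 := (measurable_of_finite d).comp (by fun_prop)
  have h2 : Measurable fun o : Obs M K => C.mean o.2.1 :=
    (measurable_of_finite C.mean).comp (by fun_prop)
  unfold Problem.logRatio
  fun_prop

/-- The relative entropy of one selection of box `m`. -/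
def Problem.divergence (C : Problem box) (d : Fin K → ℝ) (m : Fin M) : ℝ :=
  ∑ k with box k = m, C.q k * (d k ^ 2 / 2)

lemma Problem.divergence_nonneg (C : Problem box) (d : Fin K → ℝ) (m : Fin M) :
    0 ≤ C.divergence d m :=
  Finset.sum_nonneg fun k _ => mul_nonneg (C.q_pos k).le (by positivity)

lemma lintegral_boxLaw_shift {C : Problem box} (hC : C.IsUnitGaussian) (d : Fin K → ℝ) (m : Fin M)
    {F : Fin K × ℝ → ℝ≥0∞} (hF : Measurable F) :
    ∫⁻ z, F z ∂((C.shift d).boxLaw m) =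
      ∫⁻ z, F z * ENNReal.ofReal (Real.exp (C.logRatio d (m, z))) ∂(C.boxLaw m) := by
  have hm := C.measurable_logRatio d
  rw [lintegral_boxLaw _ _ hF, lintegral_boxLaw _ _ (by fun_prop)]
  refine Finset.sum_congr rfl fun k _ => ?_
  congr 1
  rw [hC k]
  exact lintegral_gaussianReal_add (C.mean k) (d k) (hF.comp measurable_prodMk_left)

lemma lintegral_boxLaw_neg_logRatio {C : Problem box} (hC : C.IsUnitGaussian) (d : Fin K → ℝ)
    (m : Fin M) :
    ∫⁻ z, ENNReal.ofReal (-C.logRatio d (m, z)) ∂(C.boxLaw m) =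
      ∫⁻ z, (ENNReal.ofReal (C.logRatio d (m, z)) + ENNReal.ofReal (C.divergence d m))
        ∂(C.boxLaw m) := by
  have hm := C.measurable_logRatio d
  rw [lintegral_add_right _ measurable_const, lintegral_const, measure_univ, mul_one,
    lintegral_boxLaw _ _ (by fun_prop), lintegral_boxLaw _ _ (by fun_prop), Problem.divergence,
    ENNReal.ofReal_sum_of_nonneg (fun k _ => mul_nonneg (C.q_pos k).le (by positivity)),
    ← Finset.sum_add_distrib]
  refine Finset.sum_congr rfl fun k _ => ?_
  rw [ENNReal.ofReal_mul (C.q_pos k).le, ← mul_add, hC k]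
  congr 1
  exact lintegral_neg_logDensity (C.mean k) (d k)

lemma lintegral_boxLaw_logRatio_le {C : Problem box} (hC : C.IsUnitGaussian) (d : Fin K → ℝ)
    (m : Fin M) :
    ∫⁻ z, ENNReal.ofReal (C.logRatio d (m, z)) ∂(C.boxLaw m) ≤
      ∑ k, ENNReal.ofReal (C.q k) *
        ∫⁻ x, ENNReal.ofReal (d k * (x - C.mean k) - d k ^ 2 / 2) ∂(gaussianReal (C.mean k) 1) := by
  have hm := C.measurable_logRatio d
  rw [lintegral_boxLaw _ _ (by fun_prop)]
  refine le_trans (le_of_eq (Finset.sum_congr rfl fun k _ => ?_))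
    (Finset.sum_le_sum_of_subset (Finset.filter_subset _ _))
  rw [hC k]
  rfl

/-! ### Change of measure -/

lemma lastObs_const {α : Type*} (c : α) (t : ℕ) (s : State M K t) :
    lastObs (fun _ => c) c t s = c := by
  cases t with
  | zero => rfl
  | succ t => cases s <;> rfl

lemma lastObs_comp {α β : Type*} (f : α → β) (g : Obs M K → α) (c : α) (t : ℕ) (s : State M K t) :
    lastObs (fun o => f (g o)) (f c) t s = f (lastObs g c t s) := by
  cases t with
  | zero => rfl
  | succ t => cases s <;> rfl

/-- The law of the process under shifted means, in terms of the likelihood ratio. -/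
lemma lintegral_law_shift {C : Problem box} (hC : C.IsUnitGaussian) (d : Fin K → ℝ)
    (π : Policy M K) (T : ℕ) {g : State M K T → ℝ≥0∞} (hg : Measurable g) :
    ∫⁻ ω, g (ω T) ∂(π.law (C.shift d)) =
      ∫⁻ ω, (∏ i ∈ range (T + 1), lastObs (fun o => ENNReal.ofReal (Real.exp (C.logRatio d o))) 1 i
        (ω i)) * g (ω T) ∂(π.law C) := by
  set z : Obs M K → ℝ≥0∞ := fun o => ENNReal.ofReal (Real.exp (C.logRatio d o)) with hz
  have hzm : Measurable z := by
    have := C.measurable_logRatio d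
    fun_prop
  induction T with
  | zero =>
    rw [lintegral_law_zero _ _ hg, ← lintegral_law_zero π C hg]
    simp [lastObs]
  | succ T ih =>
    have hk : Measurable fun s => ∫⁻ y, g y ∂(π.step (C.shift d) T s) := hg.lintegral_kernel
    have hstep : ∀ s, ∫⁻ y, g y ∂(π.step (C.shift d) T s) =
        ∫⁻ y, g y * lastObs z 1 _ y ∂(π.step C T s) := by
      intro s
      have h := lintegral_step_mul_lastObs_congr π (C.shift d) C T (g := fun _ => 1) (g' := z)
        (c := 1) measurable_const hzm hg
        (fun m F hF => by simpa using lintegral_boxLaw_shift hC d m hF) s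
      simpa only [lastObs_const, mul_one] using h
    let H : Past M K T → ℝ≥0∞ := fun x => ∏ i : Iic T, lastObs z 1 i (x i)
    have hH : Measurable H := Finset.measurable_prod _ fun i _ =>
      (measurable_lastObs hzm 1 (i : ℕ)).comp (measurable_pi_apply i)
    have hHω : ∀ ω : Traj M K, H (Preorder.frestrictLe T ω) =
        ∏ i ∈ range (T + 1), lastObs z 1 i (ω i) := by
      intro ω
      rw [Nat.range_succ_eq_Iic]
      exact Finset.prod_coe_sort (Iic T) fun i => lastObs z 1 i (ω i)
    rw [lintegral_law_succ' π _ T hg, ih hk]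
    simp_rw [hstep, ← hHω]
    rw [← lintegral_law_succ_mul π C T hH (hg.fun_mul (measurable_lastObs hzm 1 _))]
    refine lintegral_congr fun ω => ?_
    rw [hHω, Finset.prod_range_succ _ (T + 1)]
    ring

/-! ### Numbers of selections -/

/-- The probability that box `m` is selected at time `t`. -/
def selProb (π : Policy M K) (C : Problem box) (m : Fin M) (t : ℕ) : ℝ≥0∞ :=
  ∫⁻ ω, lastObs (fun o => if o.1 = m then 1 else 0) 0 (t + 1) (ω (t + 1)) ∂(π.law C)

lemma measurable_selIndicator (m : Fin M) :
    Measurable fun o : Obs M K => if o.1 = m then (1 : ℝ≥0∞) else 0 :=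
  (measurable_of_finite fun j : Fin M => if j = m then (1 : ℝ≥0∞) else 0).comp measurable_fst

lemma sum_mul_lastObs (f : Fin M → ℝ≥0∞) (t : ℕ) (s : State M K t) :
    lastObs (fun o => f o.1) 0 t s =
      ∑ m, f m * lastObs (fun o => if o.1 = m then 1 else 0) 0 t s := by
  cases t with
  | zero => simp [lastObs]
  | succ t => cases s <;> simp [lastObs]

lemma lintegral_lastObs_fst (π : Policy M K) (C : Problem box) (f : Fin M → ℝ≥0∞) (t : ℕ) :
    ∫⁻ ω, lastObs (fun o => f o.1) 0 (t + 1) (ω (t + 1)) ∂(π.law C) =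
      ∑ m, f m * selProb π C m t := by
  have h : ∀ m, Measurable fun ω : Traj M K =>
      lastObs (fun o => if o.1 = m then (1 : ℝ≥0∞) else 0) 0 (t + 1) (ω (t + 1)) := fun m =>
    (measurable_lastObs (measurable_selIndicator m) 0 (t + 1)).comp (measurable_pi_apply _)
  simp_rw [sum_mul_lastObs f]
  rw [lintegral_finsetSum _ fun m _ => (h m).const_mul _]
  refine Finset.sum_congr rfl fun m _ => lintegral_const_mul _ (h m)

lemma selProb_ne_top (π : Policy M K) (C : Problem box) (m : Fin M) (t : ℕ) :
    selProb π C m t ≠ ∞ := by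
  refine ((lintegral_mono (g := fun _ => 1) fun ω => ?_).trans_lt ?_).ne
  · rcases hs : ω (t + 1) with h | a
    · simp only [lastObs, Sum.elim_inl]
      split_ifs <;> simp
    · simp [lastObs]
  · simp

lemma measurableSet_isLeft (t : ℕ) : MeasurableSet {ω : Traj M K | (ω (t + 1)).isLeft} := by
  have h : MeasurableSet {s : State M K (t + 1) | s.isLeft} := by
    rw [measurableSet_sum_iff]
    exact ⟨by simp, by simp⟩
  exact measurable_pi_apply (t + 1) h

/-- A policy still runs at time `t + 1` exactly if the step from `t` selected a box, and that box is
unique. -/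
lemma law_isLeft (π : Policy M K) (C : Problem box) (t : ℕ) :
    π.law C {ω | (ω (t + 1)).isLeft} = ∑ m, selProb π C m t := by
  have h := lintegral_lastObs_fst π C (fun _ => 1) t
  simp only [one_mul] at h
  rw [← h, ← lintegral_indicator_one (measurableSet_isLeft t)]
  refine lintegral_congr fun ω => ?_
  rcases hs : ω (t + 1) with h | a <;> simp [Set.indicator, hs, lastObs]

/-- The expected numbers of selections of the boxes add up to at most the expected stopping time. -/
lemma sum_tsum_selProb_le (π : Policy M K) (C : Problem box) :
    ∑ m, ∑' t, selProb π C m t ≤ ∫⁻ ω, stopTime ω ∂(π.law C) := by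
  rw [← Summable.tsum_finsetSum fun m _ => ENNReal.summable]
  simp_rw [← law_isLeft, ← lintegral_indicator_one (measurableSet_isLeft _)]
  rw [← lintegral_tsum fun t => (measurable_one.indicator (measurableSet_isLeft t)).aemeasurable]
  refine lintegral_mono_ae ?_
  filter_upwards [ae_transition π C] with ω hω
  -- A trajectory that never stops has infinite stopping time, so only times `t` with a stopped
  -- state at `t + 1` matter; the indicators then vanish from `t` on.
  refine le_iInf₂ fun t ht => ?_
  have hstay : ∀ i, (ω (t + i + 1)).isRight := by
    intro i
    induction i with
    | zero => exact ht
    | succ i ih =>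
      have h := hω (t + i + 1)
      obtain ⟨a, ha⟩ := Sum.isRight_iff.1 ih
      rw [ha] at h
      have h' : (ω (t + i + 1 + 1)).isRight := by
        rcases hs : ω (t + i + 1 + 1) with x | a'
        · rw [hs] at h
          exact h.elim
        · rfl
      exact h'
  rw [tsum_eq_sum (s := range t)]
  · refine (Finset.sum_le_sum fun i _ => Set.indicator_le_self' (fun _ _ => zero_le) ω).trans ?_
    simp
  · intro i hi
    obtain ⟨j, rfl⟩ := Nat.exists_eq_add_of_le (not_lt.1 fun h => hi (Finset.mem_range.2 h))
    refine Set.indicator_of_notMem ?_ _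
    have := hstay j
    rcases hs : ω (t + j + 1) with x | a <;> simp [hs] at this ⊢

/-! ### The lower bound -/

/-- Wald's identity for one step: given the selected box, the expected log likelihood ratio is minus
its divergence, and a stopped process contributes zero. -/
lemma lintegral_neg_lastObs_logRatio {C : Problem box} (hC : C.IsUnitGaussian) (d : Fin K → ℝ)
    (π : Policy M K) (t : ℕ) :
    ∫⁻ ω, ENNReal.ofReal (-lastObs (C.logRatio d) 0 (t + 1) (ω (t + 1))) ∂(π.law C) =
      ∫⁻ ω, ENNReal.ofReal (lastObs (C.logRatio d) 0 (t + 1) (ω (t + 1))) ∂(π.law C) +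
        ∑ m, ENNReal.ofReal (C.divergence d m) * selProb π C m t := by
  have hm := C.measurable_logRatio (M := M) d
  have hdiv : Measurable fun o : Obs M K => ENNReal.ofReal (C.divergence d o.1) :=
    (measurable_of_finite fun m => ENNReal.ofReal (C.divergence d m)).comp measurable_fst
  have hpos : Measurable fun ω : Traj M K =>
      ENNReal.ofReal (lastObs (C.logRatio d) 0 (t + 1) (ω (t + 1))) :=
    ((measurable_lastObs hm 0 (t + 1)).comp (measurable_pi_apply _)).ennreal_ofReal
  have e1 : ∀ ω : Traj M K, ENNReal.ofReal (-lastObs (C.logRatio d) 0 (t + 1) (ω (t + 1))) =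
      lastObs (fun o => ENNReal.ofReal (-C.logRatio d o)) 0 (t + 1) (ω (t + 1)) := fun ω => by
    simpa using (lastObs_comp (fun x : ℝ => ENNReal.ofReal (-x)) (C.logRatio d) 0 (t + 1)
      (ω (t + 1))).symm
  have e2 : ∀ ω : Traj M K, lastObs (fun o => ENNReal.ofReal (C.logRatio d o) +
      ENNReal.ofReal (C.divergence d o.1)) 0 (t + 1) (ω (t + 1)) =
      ENNReal.ofReal (lastObs (C.logRatio d) 0 (t + 1) (ω (t + 1))) +
        lastObs (fun o => ENNReal.ofReal (C.divergence d o.1)) 0 (t + 1) (ω (t + 1)) := fun ω => by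
    rcases ω (t + 1) with h | a <;> simp [lastObs]
  simp_rw [e1]
  rw [lintegral_law_lastObs_congr π C t (by fun_prop) (hm.ennreal_ofReal.fun_add hdiv)
    (lintegral_boxLaw_neg_logRatio hC d)]
  simp_rw [e2]
  rw [lintegral_add_left hpos,
    lintegral_lastObs_fst π C (fun m => ENNReal.ofReal (C.divergence d m)) t]

lemma lintegral_lastObs_logRatio_ne_top {C : Problem box} (hC : C.IsUnitGaussian) (d : Fin K → ℝ)
    (π : Policy M K) (t : ℕ) :
    ∫⁻ ω, ENNReal.ofReal (lastObs (C.logRatio d) 0 (t + 1) (ω (t + 1))) ∂(π.law C) ≠ ∞ := by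
  have hm := C.measurable_logRatio (M := M) d
  let f : Fin M → ℝ≥0∞ := fun m => ∫⁻ z, ENNReal.ofReal (C.logRatio d (m, z)) ∂(C.boxLaw m)
  have hf : Measurable fun o : Obs M K => f o.1 := (measurable_of_finite f).comp measurable_fst
  have e1 : ∀ ω : Traj M K, ENNReal.ofReal (lastObs (C.logRatio d) 0 (t + 1) (ω (t + 1))) =
      lastObs (fun o => ENNReal.ofReal (C.logRatio d o)) 0 (t + 1) (ω (t + 1)) := fun ω => by
    simpa using (lastObs_comp ENNReal.ofReal (C.logRatio d) 0 (t + 1) (ω (t + 1))).symm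
  simp_rw [e1]
  rw [lintegral_law_lastObs_congr π C t hm.ennreal_ofReal hf (fun m => by simp [f]),
    lintegral_lastObs_fst π C f t]
  refine ENNReal.sum_ne_top.2 fun m _ => ENNReal.mul_ne_top ?_ (selProb_ne_top π C m t)
  refine ((lintegral_boxLaw_logRatio_le hC d m).trans_lt (ENNReal.sum_lt_top.2 fun k _ => ?_)).ne
  exact ENNReal.mul_lt_top ENNReal.ofReal_lt_top
    (lintegral_logDensity_ne_top (C.mean k) (d k)).lt_top

lemma integrable_lastObs_logRatio {C : Problem box} (hC : C.IsUnitGaussian) (d : Fin K → ℝ)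
    (π : Policy M K) (t : ℕ) :
    Integrable (fun ω => lastObs (C.logRatio d) 0 (t + 1) (ω (t + 1))) (π.law C) := by
  have hm : Measurable fun ω : Traj M K => lastObs (C.logRatio d) 0 (t + 1) (ω (t + 1)) :=
    (measurable_lastObs (C.measurable_logRatio d) 0 (t + 1)).comp (measurable_pi_apply _)
  refine ⟨hm.aestronglyMeasurable, ?_⟩
  have h1 := lintegral_lastObs_logRatio_ne_top hC d π t
  have h2 := lintegral_neg_lastObs_logRatio hC d π t
  have h3 : ∫⁻ ω, ENNReal.ofReal (-lastObs (C.logRatio d) 0 (t + 1) (ω (t + 1))) ∂(π.law C) ≠ ∞ := by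
    rw [h2]
    exact ENNReal.add_ne_top.2 ⟨h1, ENNReal.sum_ne_top.2 fun m _ =>
      ENNReal.mul_ne_top ENNReal.ofReal_ne_top (selProb_ne_top π C m t)⟩
  have h4 : ∀ x : ℝ, ‖x‖ₑ ≤ ENNReal.ofReal x + ENNReal.ofReal (-x) := fun x => by
    rw [Real.enorm_eq_ofReal_abs]
    rcases abs_choice x with h | h <;> rw [h] <;> simp
  refine (lintegral_mono fun ω => h4 _).trans_lt ?_
  rw [lintegral_add_left hm.ennreal_ofReal]
  exact ENNReal.add_lt_top.2 ⟨h1.lt_top, h3.lt_top⟩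

lemma integral_lastObs_logRatio {C : Problem box} (hC : C.IsUnitGaussian) (d : Fin K → ℝ)
    (π : Policy M K) (t : ℕ) :
    ∫ ω, lastObs (C.logRatio d) 0 (t + 1) (ω (t + 1)) ∂(π.law C) =
      -∑ m, C.divergence d m * (selProb π C m t).toReal := by
  rw [integral_eq_lintegral_pos_part_sub_lintegral_neg_part (integrable_lastObs_logRatio hC d π t),
    lintegral_neg_lastObs_logRatio hC d π t]
  have h : ∀ m, ENNReal.ofReal (C.divergence d m) * selProb π C m t ≠ ∞ := fun m =>
    ENNReal.mul_ne_top ENNReal.ofReal_ne_top (selProb_ne_top π C m t)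
  rw [ENNReal.toReal_add (lintegral_lastObs_logRatio_ne_top hC d π t)
    (ENNReal.sum_ne_top.2 fun m _ => h m), ENNReal.toReal_sum fun m _ => h m]
  simp_rw [ENNReal.toReal_mul, ENNReal.toReal_ofReal (C.divergence_nonneg d _)]
  ring

/-- The transportation inequality for the event that arm `b` has been declared by time `T`. -/
lemma transportation {C : Problem box} (hC : C.IsUnitGaussian) (d : Fin K → ℝ) (π : Policy M K)
    (b : Fin K) (T : ℕ) {δ : ℝ} (hδ : 0 < δ) (hδ2 : δ < 1 / 2)
    (hp' : π.law (C.shift d) {ω | ω T = Sum.inr b} ≤ ENNReal.ofReal δ) :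
    (2 * (π.law C).real {ω | ω T = Sum.inr b} - 1) * Real.log ((1 - δ) / δ) ≤
      ∑ m, C.divergence d m * ∑ t ∈ range T, (selProb π C m t).toReal := by
  set P := π.law C
  set A : Set (Traj M K) := {ω | ω T = Sum.inr b}
  have hsing : MeasurableSet ({Sum.inr b} : Set (State M K T)) := by
    rw [← Set.image_singleton]
    exact (MeasurableSet.singleton b).inr_image
  have hA : MeasurableSet A := measurable_pi_apply T hsing
  have hm := C.measurable_logRatio (M := M) d
  let l : Traj M K → ℝ := fun ω => ∑ t ∈ range T, lastObs (C.logRatio d) 0 (t + 1) (ω (t + 1))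
  have hl : Integrable l P := integrable_finsetSum _ fun t _ => integrable_lastObs_logRatio hC d π t
  have hlint : ∫ ω, l ω ∂P = -∑ m, C.divergence d m * ∑ t ∈ range T, (selProb π C m t).toReal := by
    rw [integral_finsetSum _ fun t _ => integrable_lastObs_logRatio hC d π t]
    rw [Finset.sum_congr rfl fun t _ => integral_lastObs_logRatio hC d π t]
    simp_rw [Finset.mul_sum]
    rw [Finset.sum_neg_distrib, Finset.sum_comm]
  have hlm : Measurable l := Finset.measurable_fun_sum _ fun t _ =>
    (measurable_lastObs hm 0 (t + 1)).comp (measurable_pi_apply _)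
  have hprod : ∀ ω : Traj M K, ∏ i ∈ range (T + 1),
      lastObs (fun o => ENNReal.ofReal (Real.exp (C.logRatio d o))) 1 i (ω i) =
      ENNReal.ofReal (Real.exp (l ω)) := by
    intro ω
    have e : ∀ i, lastObs (fun o => ENNReal.ofReal (Real.exp (C.logRatio d o))) 1 i (ω i) =
        ENNReal.ofReal (Real.exp (lastObs (C.logRatio d) 0 i (ω i))) := fun i => by
      simpa using lastObs_comp (fun x => ENNReal.ofReal (Real.exp x)) (C.logRatio d) 0 i (ω i)
    simp_rw [e]
    rw [← ENNReal.ofReal_prod_of_nonneg fun i _ => (Real.exp_pos _).le, ← Real.exp_sum,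
      Finset.sum_range_succ']
    simp [l, lastObs]
  have hone : ∫⁻ ω, ENNReal.ofReal (Real.exp (l ω)) ∂P = 1 := by
    have h := lintegral_law_shift hC d π T (g := fun _ => 1) measurable_const
    simp_rw [hprod] at h
    simpa using h.symm
  have hAeq : ∫⁻ ω in A, ENNReal.ofReal (Real.exp (l ω)) ∂P = π.law (C.shift d) A := by
    have h := lintegral_law_shift hC d π T (g := ({Sum.inr b} : Set (State M K T)).indicator 1)
      (measurable_one.indicator hsing)
    simp_rw [hprod] at h
    rw [← lintegral_indicator hA, ← lintegral_indicator_one hA]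
    refine Eq.trans (lintegral_congr fun ω => ?_) (h.symm.trans (lintegral_congr fun ω => ?_))
    · by_cases hω : ω ∈ A
      · have : ω T ∈ ({Sum.inr b} : Set (State M K T)) := hω
        rw [Set.indicator_of_mem hω, Set.indicator_of_mem this]; simp
      · have : ω T ∉ ({Sum.inr b} : Set (State M K T)) := hω
        rw [Set.indicator_of_notMem hω, Set.indicator_of_notMem this]; simp
    · rfl
  have hexp : Integrable (fun ω => Real.exp (l ω)) P := by
    refine ⟨hlm.exp.aestronglyMeasurable, ?_⟩
    refine (lintegral_congr fun ω => ?_).trans_lt (hone.trans_lt ENNReal.one_lt_top)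
    exact Real.enorm_of_nonneg (Real.exp_pos _).le
  have hone' : ∫ ω, Real.exp (l ω) ∂P = 1 := by
    rw [integral_eq_lintegral_of_nonneg_ae (.of_forall fun ω => (Real.exp_pos _).le)
      hlm.exp.aestronglyMeasurable, hone, ENNReal.toReal_one]
  have hA' : ∫ ω in A, Real.exp (l ω) ∂P ≤ δ := by
    rw [integral_eq_lintegral_of_nonneg_ae (.of_forall fun ω => (Real.exp_pos _).le)
      hlm.exp.aestronglyMeasurable, hAeq]
    exact ENNReal.toReal_le_of_le_ofReal hδ.le hp'
  set w := (1 - δ) / δ with hw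
  set L := Real.log w with hL
  have hδ1 : 0 < 1 - δ := by linarith
  have hw0 : 0 < w := div_pos hδ1 hδ
  have hw1 : 1 ≤ w := by rw [hw, one_le_div hδ]; linarith
  -- On `A` this is `log y ≤ y - 1` at `y = w * exp l`, off `A` at `y = w⁻¹ * exp l`. Integrating
  -- these tangent bounds takes the place of the data processing inequality. The weight `w` is the
  -- likelihood ratio of the extremal case, probabilities `1 - δ` and `δ` of `A`, so the remaining
  -- constants cancel in `h6`.
  have hpt : ∀ ω, A.indicator (fun _ => 2 * L) ω + (1 - L) - w⁻¹ * Real.exp (l ω) -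
      A.indicator (fun ω => (w - w⁻¹) * Real.exp (l ω)) ω ≤ -l ω := by
    intro ω
    by_cases hω : ω ∈ A
    · rw [Set.indicator_of_mem hω, Set.indicator_of_mem hω]
      have h := Real.add_one_le_exp (L + l ω)
      rw [Real.exp_add, hL, Real.exp_log hw0] at h
      linarith
    · rw [Set.indicator_of_notMem hω, Set.indicator_of_notMem hω]
      have h := Real.add_one_le_exp (-L + l ω)
      rw [Real.exp_add, hL, Real.exp_neg, Real.exp_log hw0] at h
      linarith
  have i1 : Integrable (A.indicator fun _ : Traj M K => 2 * L) P := (integrable_const _).indicator hA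
  have i2 : Integrable (fun ω => A.indicator (fun _ : Traj M K => 2 * L) ω + (1 - L)) P :=
    i1.add (integrable_const _)
  have i3 : Integrable (fun ω => A.indicator (fun _ : Traj M K => 2 * L) ω + (1 - L) -
    w⁻¹ * Real.exp (l ω)) P := i2.sub (hexp.const_mul _)
  have i4 : Integrable (A.indicator (fun ω => (w - w⁻¹) * Real.exp (l ω))) P :=
    (hexp.const_mul _).indicator hA
  have hmono := integral_mono (i3.sub i4) hl.neg hpt
  simp only [Pi.sub_apply, Pi.neg_apply] at hmono
  rw [integral_sub i3 i4, integral_sub i2 (hexp.const_mul _), integral_add i1 (integrable_const _),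
    integral_indicator hA, integral_indicator hA, integral_const_mul, integral_const_mul, hone',
    integral_neg, hlint, setIntegral_const, integral_const, probReal_univ] at hmono
  simp only [smul_eq_mul, neg_neg] at hmono
  rw [integral_const_mul (w - w⁻¹)] at hmono
  have hww : 0 ≤ w - w⁻¹ := by linarith [inv_le_one_of_one_le₀ hw1]
  have h5 := mul_le_mul_of_nonneg_left hA' hww
  have h6 : 1 - w⁻¹ - (w - w⁻¹) * δ = 0 := by
    rw [hw]; field_simp; ring
  linarith

/-- If the policy stops almost surely, it has declared the best arm with probability nearly `1 - δ`
at some time. -/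
lemma exists_le_law_declared {C : Problem box} {π : Policy M K} {b : Fin K} {δ : ℝ} (hδ : 0 < δ)
    (hpc : π.law C {ω | ∃ a, a ≠ b ∧ Declares ω a} ≤ ENNReal.ofReal δ)
    (hfin : ∀ m, ∑' t, selProb π C m t ≠ ∞) {ε : ℝ} (hε : 0 < ε) :
    ∃ T, 1 - δ - ε ≤ (π.law C).real {ω | ω T = Sum.inr b} := by
  set P := π.law C
  have h0 : Filter.Tendsto (fun t => ∑ m, selProb π C m t) Filter.atTop (nhds 0) := by
    have := tendsto_finsetSum (univ : Finset (Fin M)) fun m _ =>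
      ENNReal.tendsto_atTop_zero_of_tsum_ne_top (hfin m)
    simpa using this
  -- Finite expected numbers of selections force the probability of still running to tend to zero.
  obtain ⟨t, ht⟩ := (h0.eventually (gt_mem_nhds (ENNReal.ofReal_pos.2 hε))).exists
  refine ⟨t + 1, ?_⟩
  rw [← law_isLeft] at ht
  have hcover : (Set.univ : Set (Traj M K)) ⊆ ({ω | ω (t + 1) = Sum.inr b} ∪
      {ω | (ω (t + 1)).isLeft}) ∪ {ω | ∃ a, a ≠ b ∧ Declares ω a} := by
    intro ω _
    rcases hs : ω (t + 1) with x | a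
    · left; right; simp [hs]
    · by_cases hab : a = b
      · left; left; simp [hs, hab]
      · right; exact ⟨a, hab, t + 1, hs⟩
  have h1 : (1 : ℝ≥0∞) ≤ P {ω | ω (t + 1) = Sum.inr b} + ENNReal.ofReal ε + ENNReal.ofReal δ := by
    calc (1 : ℝ≥0∞) = P Set.univ := measure_univ.symm
      _ ≤ _ := measure_mono hcover
      _ ≤ _ := (measure_union_le _ _).trans (add_le_add (measure_union_le _ _) le_rfl)
      _ ≤ _ := add_le_add (add_le_add le_rfl ht.le) hpc
  rw [← ENNReal.ofReal_toReal (measure_ne_top P {ω | ω (t + 1) = Sum.inr b}),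
    ← ENNReal.ofReal_add ENNReal.toReal_nonneg hε.le,
    ← ENNReal.ofReal_add (add_nonneg ENNReal.toReal_nonneg hε.le) hδ.le, ← ENNReal.ofReal_one,
    ENNReal.ofReal_le_ofReal_iff
      (add_nonneg (add_nonneg ENNReal.toReal_nonneg hε.le) hδ.le)] at h1
  rw [measureReal_def]
  linarith

/-- A `δ`-probably correct policy has to distinguish any two instances with different best arms. -/
lemma relEntropy_le {C : Problem box} (hC : C.IsUnitGaussian) {π : Policy M K} {b : Fin K} {δ : ℝ}
    (hb : C.IsBest b) (hδ : 0 < δ) (hδ2 : δ < 1 / 2) (hπ : π.IsPC box δ)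
    (hfin : ∀ m, ∑' t, selProb π C m t ≠ ∞) (d : Fin K → ℝ) {b' : Fin K} (hbb : b' ≠ b)
    (hb' : (C.shift d).IsBest b') :
    (1 - 2 * δ) * Real.log ((1 - δ) / δ) ≤
      ∑ k, C.q k * (d k ^ 2 / 2) * (∑' t, selProb π C (box k) t).toReal := by
  have hL : 0 < Real.log ((1 - δ) / δ) := Real.log_pos (by rw [lt_div_iff₀ hδ]; linarith)
  have hbound : ∑ k, C.q k * (d k ^ 2 / 2) * (∑' t, selProb π C (box k) t).toReal =
      ∑ m, C.divergence d m * (∑' t, selProb π C m t).toReal := by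
    rw [← Finset.sum_fiberwise univ box]
    refine Finset.sum_congr rfl fun m _ => ?_
    rw [Problem.divergence, Finset.sum_mul]
    refine Finset.sum_congr rfl fun k hk => ?_
    rw [(Finset.mem_filter.1 hk).2]
  rw [hbound]
  refine le_of_forall_pos_le_add fun ε hε => ?_
  obtain ⟨T, hT⟩ := exists_le_law_declared hδ (hπ C b hb) hfin
    (div_pos hε (mul_pos two_pos hL) : 0 < ε / (2 * Real.log ((1 - δ) / δ)))
  have hsub : {ω : Traj M K | ω T = Sum.inr b} ⊆ {ω | ∃ a, a ≠ b' ∧ Declares ω a} :=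
    fun ω hω => ⟨b, hbb.symm, T, hω⟩
  have h1 := transportation hC d π b T hδ hδ2 ((measure_mono hsub).trans (hπ _ b' hb'))
  have h2 : ∑ m, C.divergence d m * ∑ t ∈ range T, (selProb π C m t).toReal ≤
      ∑ m, C.divergence d m * (∑' t, selProb π C m t).toReal := by
    refine Finset.sum_le_sum fun m _ => mul_le_mul_of_nonneg_left ?_ (C.divergence_nonneg d m)
    rw [← ENNReal.toReal_sum fun t _ => selProb_ne_top π C m t]
    exact ENNReal.toReal_mono (hfin m) (ENNReal.sum_le_tsum _)
  have h3 : (2 * (1 - δ - ε / (2 * Real.log ((1 - δ) / δ))) - 1) * Real.log ((1 - δ) / δ) =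
      (1 - 2 * δ) * Real.log ((1 - δ) / δ) - ε := by
    field_simp; ring
  have h4 : (2 * (1 - δ - ε / (2 * Real.log ((1 - δ) / δ))) - 1) * Real.log ((1 - δ) / δ) ≤
      (2 * (π.law C).real {ω | ω T = Sum.inr b} - 1) * Real.log ((1 - δ) / δ) :=
    mul_le_mul_of_nonneg_right (by linarith) hL.le
  linarith

/-- The factor `0.72 = 1.2² / 2` is the relative entropy of a shift by `1.2` gaps, in units of the
squared gap. The proof uses tangent bounds of the logarithms at `δ = 1 / 3`. -/
lemma log_le_relEntropy {δ : ℝ} (hδ : 0 < δ) (hδ2 : 2.4 * δ < 1) :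
    0.72 * Real.log (1 / (2.4 * δ)) ≤ (1 - 2 * δ) * Real.log ((1 - δ) / δ) := by
  have hδ1 : 0 < 1 - δ := by linarith
  have hy : 0 ≤ Real.log (1 / (2.4 * δ)) :=
    Real.log_nonneg (by rw [le_div_iff₀ (by positivity)]; linarith)
  have e1 : Real.log ((1 - δ) / δ) = Real.log (1 - δ) - Real.log δ := Real.log_div hδ1.ne' hδ.ne'
  have e2 : Real.log (1 / (2.4 * δ)) = -(Real.log 3 + Real.log (4 / 5)) - Real.log δ := by
    rw [one_div, Real.log_inv, Real.log_mul (by norm_num) hδ.ne',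
      show (2.4 : ℝ) = 3 * (4 / 5) by norm_num, Real.log_mul (by norm_num) (by norm_num)]
    ring
  have h1 : 2 * δ - 2 / 3 ≤ 2 * δ * (Real.log 3 + Real.log δ) := by
    have h := Real.one_sub_inv_le_log_of_pos (by positivity : 0 < 3 * δ)
    rw [Real.log_mul (by norm_num) hδ.ne'] at h
    calc 2 * δ - 2 / 3 = 2 * δ * (1 - (3 * δ)⁻¹) := by field_simp
      _ ≤ _ := mul_le_mul_of_nonneg_left h (by positivity)
  have e3 : Real.log (3 / 2 * (1 - δ)) = Real.log 3 - Real.log 2 + Real.log (1 - δ) := by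
    rw [Real.log_mul (by norm_num) hδ1.ne', Real.log_div (by norm_num) (by norm_num)]
  have h2 : 2 * (1 - δ) - 4 / 3 ≤
      2 * (1 - δ) * (Real.log 3 - Real.log 2 + Real.log (1 - δ)) := by
    have h := Real.one_sub_inv_le_log_of_pos (by positivity : 0 < 3 / 2 * (1 - δ))
    rw [e3] at h
    calc 2 * (1 - δ) - 4 / 3 = 2 * (1 - δ) * (1 - (3 / 2 * (1 - δ))⁻¹) := by field_simp; ring
      _ ≤ _ := mul_le_mul_of_nonneg_left h (by positivity)
  have h3 : Real.log 3 - Real.log 2 + Real.log (1 - δ) ≤ 3 / 2 * (1 - δ) - 1 := by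
    rw [← e3]
    exact Real.log_le_sub_one_of_pos (by positivity)
  have h4 : 0 ≤ 3 * Real.log (4 / 5) + Real.log 2 := by
    have h : (3 : ℝ) * Real.log (4 / 5) = Real.log ((4 / 5) ^ 3) := by
      rw [Real.log_pow]; norm_num
    rw [h, ← Real.log_mul (by norm_num) (by norm_num)]
    exact Real.log_nonneg (by norm_num)
  have h5 := Real.log_two_gt_d9
  have h6 := Real.log_two_lt_d9
  rw [e2] at hy ⊢
  rw [e1]
  -- For `δ ≥ 1 / 3` the tangent bounds give the inequality even with factor one. For smaller `δ`
  -- they fall slightly short of that, and the spare `0.28 * log (1 / (2.4 δ)) ≥ 0.056` covers the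
  -- deficit.
  rcases le_total (1 / 3) δ with h | h
  · have h7 := mul_nonneg (by linarith : 0 ≤ 3 / 2 - 2 * Real.log 2) (sub_nonneg.2 h)
    linarith
  · have h7 : 1 / 5 ≤ -(Real.log 3 + Real.log (4 / 5)) - Real.log δ := by
      have h8 : Real.log δ ≤ -Real.log 3 := by
        rw [← Real.log_inv]
        exact Real.log_le_log hδ (by linarith)
      have h9 := Real.log_le_sub_one_of_pos (by norm_num : (0 : ℝ) < 4 / 5)
      linarith
    have h10 := mul_nonneg (by linarith : 0 ≤ 3 / 2 - 2 * Real.log 2) hδ.le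
    linarith

/-- The expected number of selections of the box of an arm. -/
lemma log_le_mul_tsum_selProb {C : Problem box} (hC : C.IsUnitGaussian) {π : Policy M K} {b : Fin K}
    {δ : ℝ} (hK : 2 ≤ K) (hb : C.IsBest b) (hδ : 0 < δ) (hδ2 : 2.4 * δ < 1) (hπ : π.IsPC box δ)
    (hfin : ∀ m, ∑' t, selProb π C m t ≠ ∞) (k : Fin K) :
    Real.log (1 / (2.4 * δ)) ≤
      C.q k * C.gap b k ^ 2 * (∑' t, selProb π C (box k) t).toReal := by
  have hlog := log_le_relEntropy hδ hδ2
  have hδ3 : δ < 1 / 2 := by linarith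
  have hgap := Problem.gap_pos hK hb k
  by_cases hk : k = b
  · subst hk
    have : Nontrivial (Fin K) := Fin.nontrivial_iff_two_le.2 hK
    obtain ⟨j₀, hj₀⟩ := exists_ne k
    have : Nonempty {j : Fin K // j ≠ k} := ⟨⟨j₀, hj₀⟩⟩
    obtain ⟨⟨j, hjk⟩, hj⟩ := exists_eq_ciInf_of_finite (f := fun j : {j : Fin K // j ≠ k} =>
      C.mean k - C.mean j)
    have hg : C.gap k k = C.mean k - C.mean j := by rw [Problem.gap, if_pos rfl, ← hj]
    set a := C.q j * (∑' t, selProb π C (box j) t).toReal with ha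
    have ha0 : 0 ≤ a := mul_nonneg (C.q_pos j).le ENNReal.toReal_nonneg
    refine le_of_forall_pos_le_add fun ε hε => ?_
    set η := √(ε / (a + 1)) with hη
    have hη0 : 0 < η := Real.sqrt_pos.2 (by positivity)
    have hη2 : η ^ 2 = ε / (a + 1) := Real.sq_sqrt (by positivity)
    have hηa : a * η ^ 2 ≤ ε := by
      rw [hη2, mul_div_assoc', div_le_iff₀ (by positivity)]
      nlinarith
    -- Lowering the best arm might leave several runners-up tied, so `j` is raised by `η` to make it
    -- the unique best. The cost is at most `ε / 2`, as `a * η ^ 2 ≤ ε`.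
    let d : Fin K → ℝ := Function.update (Pi.single j η) k (-(1.2 * C.gap k k))
    have hdk : d k = -(1.2 * C.gap k k) := Function.update_self _ _ _
    have hdj : d j = η := by simp [d, hjk]
    have hdi : ∀ i, i ≠ k → i ≠ j → d i = 0 := fun i hik hij => by simp [d, hik, hij]
    have hbest : (C.shift d).IsBest j := by
      intro i hij
      rw [C.mean_shift, C.mean_shift, hdj]
      by_cases hik : i = k
      · subst hik
        rw [hdk]
        linarith
      · rw [hdi i hik hij]
        have := Problem.gap_best_le (C := C) hik
        linarith
    have h := relEntropy_le hC hb hδ hδ3 hπ hfin d hjk hbest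
    have hsum : ∑ i, C.q i * (d i ^ 2 / 2) * (∑' t, selProb π C (box i) t).toReal =
        0.72 * (C.q k * C.gap k k ^ 2 * (∑' t, selProb π C (box k) t).toReal) +
          a * η ^ 2 / 2 := by
      rw [Finset.sum_eq_add k j hjk.symm (fun i _ hi => by simp [hdi i hi.1 hi.2])
        (by simp) (by simp), hdk, hdj, ha]
      ring
    rw [hsum] at h
    linarith
  · have hg : C.gap b k = C.mean b - C.mean k := if_neg hk
    -- A shift by exactly the gap would only tie `k` with `b`. The factor `1.2` makes `k` strictly
    -- best, at a cost that the constant of the theorem allows.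
    have hbest : (C.shift (Pi.single k (1.2 * C.gap b k))).IsBest k := by
      intro i hik
      rw [C.mean_shift, C.mean_shift, Pi.single_eq_same, Pi.single_eq_of_ne hik]
      have : C.mean i ≤ C.mean b := by
        by_cases hib : i = b
        · rw [hib]
        · exact (hb i hib).le
      linarith
    have h := relEntropy_le hC hb hδ hδ3 hπ hfin _ hk hbest
    rw [Finset.sum_eq_single k (fun i _ hi => by simp [Pi.single_eq_of_ne hi]) (by simp),
      Pi.single_eq_same] at h
    linarith

theorem lower_bound (C : Problem box) (b : Fin K) (δ : ℝ) (π : Policy M K) (hK : 2 ≤ K)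
    (hb : C.IsBest b) (hC : C.IsUnitGaussian) (hδ : 0 < δ) (hπ : π.IsPC box δ) :
    ENNReal.ofReal (Real.log (1 / (2.4 * δ)) *
        ∑ m, ⨆ k : {k : Fin K // box k = m}, 1 / (C.q k * C.gap b k ^ 2)) ≤
      ∫⁻ ω, stopTime ω ∂(π.law C) := by
  have hterm : ∀ k, 0 < C.q k * C.gap b k ^ 2 := fun k =>
    mul_pos (C.q_pos k) (pow_pos (Problem.gap_pos hK hb k) 2)
  have hsum := sum_tsum_selProb_le π C
  rcases le_or_gt 1 (2.4 * δ) with hδ2 | hδ2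
  · have hlog : Real.log (1 / (2.4 * δ)) ≤ 0 :=
      Real.log_nonpos (by positivity) (by rw [div_le_one (by positivity)]; exact hδ2)
    rw [ENNReal.ofReal_of_nonpos]
    · exact zero_le
    · exact mul_nonpos_of_nonpos_of_nonneg hlog (Finset.sum_nonneg fun m _ =>
        Real.iSup_nonneg fun k => (one_div_pos.2 (hterm k)).le)
  by_cases htop : ∑ m, ∑' t, selProb π C m t = ∞
  · rw [htop] at hsum
    rw [top_le_iff.1 hsum]
    exact le_top
  have hfin : ∀ m, ∑' t, selProb π C m t ≠ ∞ := fun m =>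
    ENNReal.sum_ne_top.1 htop m (Finset.mem_univ m)
  refine le_trans ?_ hsum
  rw [← ENNReal.ofReal_toReal htop, ENNReal.toReal_sum fun m _ => hfin m, Finset.mul_sum]
  refine ENNReal.ofReal_le_ofReal (Finset.sum_le_sum fun m _ => ?_)
  obtain ⟨k₀, hk₀⟩ := C.exists_box_eq m
  have : Nonempty {k : Fin K // box k = m} := ⟨⟨k₀, hk₀⟩⟩
  -- Each box is charged only for its hardest arm. Its selections are counted once, so the bounds
  -- add up over the boxes.
  obtain ⟨⟨k, hk⟩, hmax⟩ := exists_eq_ciSup_of_finite (f := fun k : {k : Fin K // box k = m} =>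
    1 / (C.q k * C.gap b k ^ 2))
  rw [← hmax]
  subst hk
  rw [mul_one_div, div_le_iff₀' (hterm k)]
  exact log_le_mul_tsum_selProb hC hK hb hδ hδ2 hπ hfin k

end BoxedBandit

end

theorem theorem3 :
    -- correctness and stopping time of the algorithm
    (∀ {M K : ℕ} [NeZero K] (box : Fin K → Fin M) (C : Problem box) (b : Fin K) (δ : ℝ),
      2 ≤ K → C.IsBest b → 0 < δ → δ < 1 →
        ENNReal.ofReal (1 - δ) < (bbsea box δ).law C
          {ω | Declares ω b ∧ stopTime ω ≤ ENNReal.ofReal (∑ m, C.beta b δ m)}) ∧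
    -- order of the bound, uniformly over instances with bounded gaps and `K / (δ Δ)` away from `1`
    (∀ D r : ℝ, 1 < r → ∃ c : ℝ, 0 < c ∧
      ∀ {M K : ℕ} (box : Fin K → Fin M) (C : Problem box) (b : Fin K) (δ : ℝ),
        2 ≤ K → C.IsBest b → 0 < δ → δ < 1 →
        ∀ m, (∀ k, box k = m → C.gap b k ≤ D ∧ r ≤ K / (δ * C.gap b k)) →
          C.beta b δ m ≤ c * ⨆ k : {k : Fin K // box k = m},
            Real.log (K / (δ * C.gap b k)) / (C.q k * C.gap b k ^ 2)) ∧
    -- lower bound for every `δ`-probably correct policy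
    (∀ {M K : ℕ} (box : Fin K → Fin M) (C : Problem box) (b : Fin K) (δ : ℝ) (π : Policy M K),
      2 ≤ K → C.IsBest b → C.IsUnitGaussian → 0 < δ → δ < 1 → π.IsPC box δ →
        ENNReal.ofReal (Real.log (1 / (2.4 * δ)) *
            ∑ m, ⨆ k : {k : Fin K // box k = m}, 1 / (C.q k * C.gap b k ^ 2)) ≤
          ∫⁻ ω, stopTime ω ∂(π.law C)) :=
  ⟨fun _ C b δ hK hb hδ hδ1 => bbsea_correct C b δ hK hb hδ hδ1, beta_le,
    fun _ C b δ π hK hb hC hδ _ hπ => lower_bound C b δ π hK hb hC hδ hπ⟩
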